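/- **Setting.** Consider $x(k+1)=(\hat A+\Delta_A)x(k)+(\hat B+\Delta_B)u(k)+w(k)$ with $x(k)\in\mathbb R^{n_x}$, $u(k)\in\mathbb R^{n_u}$, where the uncertainty is unknown but satisfies $\Delta_A\in\mathcal P_A=\{\|\Delta_A\|_{\infty\to\infty}\le\epsilon_A\}$, $\Delta_B\in\mathcal P_B=\{\|\Delta_B\|_{\infty\to\infty}\le\epsilon_B\}$, $w(k)\in\mathcal W=\{\|w\|_\infty\le\sigma_w\}$, with $\epsilon_A,\epsilon_B\ge 0$ and $\sigma_w>0$. The sets $\mathcal X=\{F_xx\le b_x\}$, $\mathcal U=\{F_uu\le b_u\}$, $\mathcal X_T=\{F_Tx\le b_T\}$ are compact polytopes with the origin in their interior. Let $T_{\max}\ge1$. For a horizon $T\ge1$ let $\hat{\mathcal A}=\mathrm{blkdiag}(\hat A,\dots,\hat A,0)$, $\hat{\mathcal B}=\mathrm{blkdiag}(\hat B,\dots,\hat B,0)$ ($T+1$ blocks) and let $Z$ be the block-downshift operator. For $x_0\in\mathbb R^{n_x}$, let $J_T^*(x_0)$ be the optimal value ($\infty$ if infeasible) of the following program over block-lower-triangular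 $\Phi_x,\Phi_u$, whose blocks in row $t$ and column $j$ ($0\le j\le t\le T$) are denoted $\Phi_x^{t,t-j},\Phi_u^{t,t-j}$, and over $\sigma_0,\dots,\sigma_{T-1}\in\mathbb R$: $$\min\ \sum_{t=0}^{T-1}\big(\hat x_t^\top Q\hat x_t+\hat u_t^\top R\hat u_t\big)+\hat x_T^\top Q_T\hat x_T,\qquad \hat x_t=\Phi_x^{t,t}x_0,\ \hat u_t=\Phi_u^{t,t}x_0,$$ subject to $(I-Z\hat{\mathcal A})\Phi_x-Z\hat{\mathcal B}\Phi_u=\mathrm{blkdiag}(I,\sigma_0I,\dots,\sigma_{T-1}I)$; for $0\le t\le T-1$ $$\epsilon_A\Big(\|\Phi_x^{t,t}x_0\|_\infty+\sum_{i=1}^t\|\Phi_x^{t,t-i}\|_{\infty\to\infty}\Big)+\epsilon_B\Big(\|\Phi_u^{t,t}x_0\|_\infty+\sum_{i=1}^t\|\Phi_u^{t,t-i}\|_{\infty\to\infty}\Big)+\sigma_w\le\sigma_t;$$ and the tightened constraints $f^\top\Phi_x^{t,t}x_0+\sum_{i=1}^t\|f^\top\Phi_x^{t,t-i}\|_1\le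 b$ for every row $(f,b)$ of $(F_x,b_x)$ and $0\le t\le T-1$, the same with $\Phi_u$ for the rows of $(F_u,b_u)$ and $0\le t\le T-1$, and the same with $\Phi_x$ for the rows of $(F_T,b_T)$ and $t=T$. Put $J^*_{MPC}(x)=\min_{1\le T\le T_{\max}}J_T^*(x)$ and let $\mathcal F=\{x: J^*_{MPC}(x)<\infty\}$ be the feasible set. An MPC policy is a family $u^k_{MPC}:\mathcal F\to\mathbb R^{n_u}$, $k\ge0$, such that $u_{MPC}^k(x)=\Phi_u^{0,0}x$ for some optimal solution at $x$ with some horizon $T\le T_{\max}$ minimizing $J_T^*(x)$. The closed loop is $$x(k+1)=\hat Ax(k)+\hat Bu_{MPC}^k(x(k))+\eta(k),\qquad \eta(k)=\Delta_Ax(k)+\Delta_Bu^k_{MPC}(x(k))+w(k).$$ For a set $S$ let $\mathrm{Pre}(S)$ be the set of $x\in\mathcal F$ from which the closed loop enters $S$ in one step, at every time $k$ and for all $\Delta_A\in\mathcal P_A,\Delta_B\in\mathcal P_B,w\in\mathcal W$. Put $\mathcal C_0=\mathcal X_T$, $\mathcal C_{N+1}=\mathrm{Pre}(\mathcal C_N)\cap\mathcal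 X$; the region of attraction is $\mathcal R=\bigcup_{N=0}^{T_{\max}}\mathcal C_N$. A function $V:\mathbb R^{n_x}\to[0,\infty]$ is an *ISS-Lyapunov function on $S\subseteq\mathcal F$* if there are $\alpha_1,\alpha_2,\alpha_3\in\mathcal K_\infty$ and $\sigma\in\mathcal K$ with $\alpha_1(\|x\|_\infty)\le V(x)\le\alpha_2(\|x\|_\infty)$ and $V(x^+)-V(x)\le-\alpha_3(\|x\|_\infty)+\sigma(\|\eta\|_\infty)$ (in particular $V(x^+)<\infty$) for all $x\in S$ and every closed-loop successor $x^+$ of $x$ with lumped uncertainty $\eta$. The *ISS estimate holds on $S$* if there are $\beta\in\mathcal{KL}$, $\gamma\in\mathcal K$ such that every closed-loop trajectory with $x(0)\in S$ stays in $\mathcal F$ (hence exists for all times) and satisfies $\|x(k)\|_\infty\le\beta(\|x(0)\|_\infty,k)+\gamma(\max_{0\le t\le k}\|\eta(t)\|_\infty)$ for all $k\ge 0$. The closed loop is *ISS in $S$* if $S$ is compact with the origin in its interior, $S$ is robust forward invariant ($S\subseteq\mathrm{Pre}(S)$), and the ISS estimate holds on $S$. **Theorem.** Assume that for some $K\in\mathbb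 R^{n_u\times n_x}$: (i) $\hat A+\Delta_A+(\hat B+\Delta_B)K$ is Schur stable for all $\Delta_A\in\mathcal P_A,\Delta_B\in\mathcal P_B$; (ii) for all $x\in\mathcal X_T$: $x\in\mathcal X$, $Kx\in\mathcal U$ and $(\hat A+\Delta_A+(\hat B+\Delta_B)K)x+w\in\mathcal X_T$ for all $\Delta_A\in\mathcal P_A,\Delta_B\in\mathcal P_B,w\in\mathcal W$; (iii) $Q\succ0$, $R\succ0$; (iv) $Q_T\succ0$ and $x^\top\big(-Q_T+Q+K^\top RK+(\hat A+\hat BK)^\top Q_T(\hat A+\hat BK)\big)x\le0$ for all $x\in\mathcal X_T$. Then the minima defining the controller are attained at every $x\in\mathcal F$, and for every MPC policy: 1. the origin is an interior point of $\mathcal R$, and $\mathcal R\subseteq\mathcal F$; 2. $J^*_{MPC}$ is an ISS-Lyapunov function on $\mathcal R$, and the ISS estimate (with respect to the lumped uncertainty $\eta$) holds on $\mathcal R$; 3. moreover $J^*_{MPC}$ is an ISS-Lyapunov function on the whole feasible set $\mathcal F\supseteq\mathcal R$, and the closed loop is ISS in $\mathcal F$. -/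

import Mathlib

open scoped NNReal ENNReal Matrix

/-- The class `𝒦`: continuous, strictly increasing, vanishing at zero. -/
def IsClassK (γ : ℝ≥0 → ℝ≥0) : Prop :=
  Continuous γ ∧ StrictMono γ ∧ γ 0 = 0

/-- The class `𝒦_∞`. -/
def IsClassKInf (γ : ℝ≥0 → ℝ≥0) : Prop :=
  IsClassK γ ∧ Filter.Tendsto γ Filter.atTop Filter.atTop

/-- The class `𝒦ℒ`. -/
def IsClassKL (β : ℝ≥0 → ℝ≥0 → ℝ≥0) : Prop :=
  (∀ t, IsClassK fun s => β s t) ∧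
    ∀ s, Antitone (β s) ∧ Filter.Tendsto (β s) Filter.atTop (nhds 0)

/-- The `ℓ_∞ → ℓ_∞` induced norm of a matrix (`Fin n → ℝ` carries the sup norm). -/
noncomputable def indNorm {m n : ℕ} (M : Matrix (Fin m) (Fin n) ℝ) : ℝ :=
  ‖LinearMap.toContinuousLinearMap (Matrix.toLin' M)‖

/-- The `ℓ_1` norm of a vector. -/
def l1Norm {n : ℕ} (v : Fin n → ℝ) : ℝ := ∑ i, |v i|

/-- The polytope `{x | F x ≤ b}`. -/
def polytope {m n : ℕ} (F : Matrix (Fin m) (Fin n) ℝ) (b : Fin m → ℝ) : Set (Fin n → ℝ) :=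
  {x | F *ᵥ x ≤ b}

/-- A real square matrix is (Schur) stable: its complex eigenvalues lie in the open unit disk. -/
def IsSchurStable {n : ℕ} (M : Matrix (Fin n) (Fin n) ℝ) : Prop :=
  ∀ z ∈ spectrum ℂ (M.map (algebraMap ℝ ℂ)), ‖z‖ < 1

/-- A matrix acting on signals over the horizon `0, …, T`; the second component of an index is
the time. -/
abbrev HorizonMatrix (T p q : ℕ) : Type :=
  Matrix (Fin p × Fin (T + 1)) (Fin q × Fin (T + 1)) ℝ

/-- The block in block row `i` and block column `j`. In the notation by superscripts this is
`Φ^{i, i - j}`. -/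
def HorizonMatrix.block {T p q : ℕ} (Φ : HorizonMatrix T p q) (i j : Fin (T + 1)) :
    Matrix (Fin p) (Fin q) ℝ :=
  Matrix.of fun a b => Φ (a, i) (b, j)

/-- Block-lower-triangular matrices, i.e. causal linear time-varying operators. -/
def HorizonMatrix.IsCausal {T p q : ℕ} (Φ : HorizonMatrix T p q) : Prop :=
  ∀ i j, i < j → Φ.block i j = 0

/-- `blkdiag(M, …, M, 0)`. -/
def stackMatrix (T : ℕ) {p q : ℕ} (M : Matrix (Fin p) (Fin q) ℝ) : HorizonMatrix T p q :=
  Matrix.blockDiagonal fun t : Fin (T + 1) => if t = Fin.last T then 0 else M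

/-- The block-downshift operator: identity blocks on the first block sub-diagonal. -/
def downshift (T n : ℕ) : HorizonMatrix T n n :=
  Matrix.of fun a b => if a.1 = b.1 ∧ (a.2 : ℕ) = (b.2 : ℕ) + 1 then 1 else 0

/-- The filter `Σ = blkdiag(I, σ_0 I, …, σ_{T-1} I)`. -/
def noiseFilter {T : ℕ} (n : ℕ) (σ : Fin T → ℝ) : HorizonMatrix T n n :=
  Matrix.blockDiagonal (Fin.cons 1 fun t => σ t • (1 : Matrix (Fin n) (Fin n) ℝ))

/-- The decision variables of the convex program with horizon `T`: the system responses and the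
bounds `σ_0, …, σ_{T-1}` on the lumped uncertainty. -/
structure SLSVar (T nx nu : ℕ) where
  Φx : HorizonMatrix T nx nx
  Φu : HorizonMatrix T nu nx
  σ : Fin T → ℝ

/-- Row `r` of the tightened constraint `F y_t ≤ b` for the signal `y = Φ w̃`: the constraint
holds for all normalized disturbances of norm at most one. -/
def Tightened {T m p q : ℕ} (F : Matrix (Fin m) (Fin p) ℝ) (b : Fin m → ℝ)
    (Φ : HorizonMatrix T p q) (x₀ : Fin q → ℝ) (t : Fin (T + 1)) : Prop :=
  ∀ r, F r ⬝ᵥ (Φ.block t 0 *ᵥ x₀) + ∑ i ∈ Finset.Ioc 0 t, l1Norm (F r ᵥ* Φ.block t i) ≤ b r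

/-- The bound `‖Φ^{t,t} x₀‖_∞ + ∑_{i=1}^t ‖Φ^{t,t-i}‖_{∞→∞}` on the size of the signal at
time `t`. -/
noncomputable def responseBound {T p q : ℕ} (Φ : HorizonMatrix T p q) (x₀ : Fin q → ℝ)
    (t : Fin (T + 1)) : ℝ :=
  ‖Φ.block t 0 *ᵥ x₀‖ + ∑ i ∈ Finset.Ioc 0 t, indNorm (Φ.block t i)

/-- The data of the robust MPC problem: nominal dynamics, uncertainty levels, polytopic
state, input and terminal constraints, cost weights and the largest horizon. -/
structure RobustMPC (nx nu : ℕ) where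
  A : Matrix (Fin nx) (Fin nx) ℝ
  B : Matrix (Fin nx) (Fin nu) ℝ
  εA : ℝ
  εB : ℝ
  σw : ℝ
  mX : ℕ
  FX : Matrix (Fin mX) (Fin nx) ℝ
  bX : Fin mX → ℝ
  mU : ℕ
  FU : Matrix (Fin mU) (Fin nu) ℝ
  bU : Fin mU → ℝ
  mT : ℕ
  FT : Matrix (Fin mT) (Fin nx) ℝ
  bT : Fin mT → ℝ
  Q : Matrix (Fin nx) (Fin nx) ℝ
  R : Matrix (Fin nu) (Fin nu) ℝ
  QT : Matrix (Fin nx) (Fin nx) ℝ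
  Tmax : ℕ

namespace RobustMPC

variable {nx nu : ℕ} (P : RobustMPC nx nu)

/-- The state constraint set `𝒳`. -/
def stateSet : Set (Fin nx → ℝ) := polytope P.FX P.bX

/-- The input constraint set `𝒰`. -/
def inputSet : Set (Fin nu → ℝ) := polytope P.FU P.bU

/-- The terminal set `𝒳_T`. -/
def terminalSet : Set (Fin nx → ℝ) := polytope P.FT P.bT

/-- The admissible uncertainties `Δ_A ∈ 𝒫_A`. -/
def setPA : Set (Matrix (Fin nx) (Fin nx) ℝ) := {Δ | indNorm Δ ≤ P.εA}

/-- The admissible uncertainties `Δ_B ∈ 𝒫_B`. -/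
def setPB : Set (Matrix (Fin nx) (Fin nu) ℝ) := {Δ | indNorm Δ ≤ P.εB}

/-- The admissible additive disturbances `w ∈ 𝒲`. -/
def setW : Set (Fin nx → ℝ) := {w | ‖w‖ ≤ P.σw}

/-- Standing assumptions on the problem data. -/
structure Standing : Prop where
  εA_nonneg : 0 ≤ P.εA
  εB_nonneg : 0 ≤ P.εB
  σw_pos : 0 < P.σw
  one_le_Tmax : 1 ≤ P.Tmax
  isCompact_stateSet : IsCompact P.stateSet
  isCompact_inputSet : IsCompact P.inputSet
  isCompact_terminalSet : IsCompact P.terminalSet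
  zero_mem_stateSet : 0 ∈ interior P.stateSet
  zero_mem_inputSet : 0 ∈ interior P.inputSet
  zero_mem_terminalSet : 0 ∈ interior P.terminalSet

/-- The local controller `x ↦ K x` robustly stabilizes the uncertain system. -/
def RobustlyStabilizing (K : Matrix (Fin nu) (Fin nx) ℝ) : Prop :=
  ∀ ΔA ∈ P.setPA, ∀ ΔB ∈ P.setPB, IsSchurStable (P.A + ΔA + (P.B + ΔB) * K)

/-- The terminal set is robust forward invariant under the local controller, which respects the
constraints there. -/
def TerminalInvariant (K : Matrix (Fin nu) (Fin nx) ℝ) : Prop :=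
  ∀ x ∈ P.terminalSet, x ∈ P.stateSet ∧ K *ᵥ x ∈ P.inputSet ∧
    ∀ ΔA ∈ P.setPA, ∀ ΔB ∈ P.setPB, ∀ w ∈ P.setW,
      (P.A + ΔA + (P.B + ΔB) * K) *ᵥ x + w ∈ P.terminalSet

/-- The terminal cost decreases along the nominal local closed loop on the terminal set. -/
def LocalLyapunov (K : Matrix (Fin nu) (Fin nx) ℝ) : Prop :=
  ∀ x ∈ P.terminalSet,
    x ⬝ᵥ ((-P.QT + (P.Q + Kᵀ * P.R * K) + (P.A + P.B * K)ᵀ * P.QT * (P.A + P.B * K)) *ᵥ x) ≤ 0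

/-- The constraints of the convex program with horizon `T` and initial state `x₀`. -/
structure Feasible (T : ℕ) (x₀ : Fin nx → ℝ) (s : SLSVar T nx nu) : Prop where
  causal_x : s.Φx.IsCausal
  causal_u : s.Φu.IsCausal
  affine : (1 - downshift T nx * stackMatrix T P.A) * s.Φx
      - (downshift T nx * stackMatrix T P.B) * s.Φu = noiseFilter nx s.σ
  noise_bound : ∀ t : Fin T, P.εA * responseBound s.Φx x₀ t.castSucc
      + P.εB * responseBound s.Φu x₀ t.castSucc + P.σw ≤ s.σ t
  state : ∀ t : Fin T, Tightened P.FX P.bX s.Φx x₀ t.castSucc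
  input : ∀ t : Fin T, Tightened P.FU P.bU s.Φu x₀ t.castSucc
  terminal : Tightened P.FT P.bT s.Φx x₀ (Fin.last T)

/-- The nominal cost: `Φx(:,0) x₀` and `Φu(:,0) x₀` are the nominal states and inputs. -/
def cost (T : ℕ) (x₀ : Fin nx → ℝ) (s : SLSVar T nx nu) : ℝ :=
  (∑ t : Fin T,
    ((s.Φx.block t.castSucc 0 *ᵥ x₀) ⬝ᵥ (P.Q *ᵥ (s.Φx.block t.castSucc 0 *ᵥ x₀))
      + (s.Φu.block t.castSucc 0 *ᵥ x₀) ⬝ᵥ (P.R *ᵥ (s.Φu.block t.castSucc 0 *ᵥ x₀))))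
  + (s.Φx.block (Fin.last T) 0 *ᵥ x₀) ⬝ᵥ (P.QT *ᵥ (s.Φx.block (Fin.last T) 0 *ᵥ x₀))

/-- The optimal value `J*_T(x)`, which is `∞` if the program with horizon `T` is infeasible. -/
noncomputable def optValue (T : ℕ) (x : Fin nx → ℝ) : ℝ≥0∞ :=
  ⨅ (s : SLSVar T nx nu) (_ : P.Feasible T x s), ENNReal.ofReal (P.cost T x s)

/-- The value function `J*_MPC(x)`, the minimum of `J*_T(x)` over `1 ≤ T ≤ T_max`. -/
noncomputable def valueFn (x : Fin nx → ℝ) : ℝ≥0∞ :=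
  ⨅ T ∈ Finset.Icc 1 P.Tmax, P.optValue T x

/-- `s` is an optimal solution of the program with horizon `T`. -/
def IsOptimal (T : ℕ) (x : Fin nx → ℝ) (s : SLSVar T nx nu) : Prop :=
  P.Feasible T x s ∧ ENNReal.ofReal (P.cost T x s) = P.optValue T x

/-- The states at which the program is feasible for some horizon `1 ≤ T ≤ T_max`, i.e. at which
the controller is defined. -/
def feasibleSet : Set (Fin nx → ℝ) :=
  {x | ∃ T ∈ Finset.Icc 1 P.Tmax, ∃ s : SLSVar T nx nu, P.Feasible T x s}

/-- The inputs `Φu^{0,0} x` given by the optimal solutions at `x` for the horizons that minimize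
`J*_T(x)`; minimizers need not be unique. -/
def mpcInputs (x : Fin nx → ℝ) : Set (Fin nu → ℝ) :=
  {u | ∃ T ∈ Finset.Icc 1 P.Tmax, P.optValue T x = P.valueFn x ∧
    ∃ s : SLSVar T nx nu, P.IsOptimal T x s ∧ u = s.Φu.block 0 0 *ᵥ x}

/-- `μ k` is the adaptive-horizon MPC control law at time `k` (for any choice among minimizers);
its values outside the feasible set are irrelevant. -/
def IsMPCPolicy (μ : ℕ → (Fin nx → ℝ) → (Fin nu → ℝ)) : Prop :=
  ∀ k, ∀ x ∈ P.feasibleSet, μ k x ∈ P.mpcInputs x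

/-- The successor state `Â x + B̂ u + η`. -/
def succ (x : Fin nx → ℝ) (u : Fin nu → ℝ) (η : Fin nx → ℝ) : Fin nx → ℝ :=
  P.A *ᵥ x + P.B *ᵥ u + η

end RobustMPC

/-- The lumped uncertainty `η = Δ_A x + Δ_B u + w`. -/
def lumped {nx nu : ℕ} (ΔA : Matrix (Fin nx) (Fin nx) ℝ) (ΔB : Matrix (Fin nx) (Fin nu) ℝ)
    (x : Fin nx → ℝ) (u : Fin nu → ℝ) (w : Fin nx → ℝ) : Fin nx → ℝ :=
  ΔA *ᵥ x + ΔB *ᵥ u + w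

namespace RobustMPC

variable {nx nu : ℕ} (P : RobustMPC nx nu) (μ : ℕ → (Fin nx → ℝ) → (Fin nu → ℝ))

/-- The preset of `S` for the closed loop: the states at which the controller is defined and from
which the closed loop enters `S` in one step for all uncertainties. -/
def pre (S : Set (Fin nx → ℝ)) : Set (Fin nx → ℝ) :=
  {x | x ∈ P.feasibleSet ∧ ∀ k, ∀ ΔA ∈ P.setPA, ∀ ΔB ∈ P.setPB, ∀ w ∈ P.setW,
    P.succ x (μ k x) (lumped ΔA ΔB x (μ k x) w) ∈ S}

/-- The `N`-step robust controllable set to `S` of the closed loop. -/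
def controllable (S : Set (Fin nx → ℝ)) : ℕ → Set (Fin nx → ℝ)
  | 0 => S
  | N + 1 => P.pre μ (controllable S N) ∩ P.stateSet

/-- The region of attraction: the union of the `N`-step robust controllable sets to the terminal
set, `0 ≤ N ≤ T_max`. -/
def roa : Set (Fin nx → ℝ) :=
  ⋃ N ∈ Finset.range (P.Tmax + 1), P.controllable μ P.terminalSet N

/-- `x` is a closed-loop trajectory with lumped uncertainty `η`, for some admissible model
uncertainty and additive disturbances. -/
def IsTrajectory (x η : ℕ → Fin nx → ℝ) : Prop :=
  ∃ ΔA ∈ P.setPA, ∃ ΔB ∈ P.setPB, ∃ w : ℕ → Fin nx → ℝ, ∀ k,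
    w k ∈ P.setW ∧ η k = lumped ΔA ΔB (x k) (μ k (x k)) (w k) ∧
      x (k + 1) = P.succ (x k) (μ k (x k)) (η k)

/-- `S` is robust forward invariant for the closed loop (whose controller is defined on `S`). -/
def RobustInvariant (S : Set (Fin nx → ℝ)) : Prop :=
  S ⊆ P.pre μ S

/-- The ISS bound for the trajectories that start in `S`. The controller stays defined along
them, so that they exist for all times. -/
def ISSEstimate (S : Set (Fin nx → ℝ)) : Prop :=
  ∃ (β : ℝ≥0 → ℝ≥0 → ℝ≥0) (γ : ℝ≥0 → ℝ≥0), IsClassKL β ∧ IsClassK γ ∧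
    ∀ x η, P.IsTrajectory μ x η → x 0 ∈ S → ∀ k : ℕ, x k ∈ P.feasibleSet ∧
      ‖x k‖₊ ≤ β ‖x 0‖₊ k + γ ((Finset.range (k + 1)).sup fun t => ‖η t‖₊)

/-- The closed loop is input-to-state stable in `S` with respect to the lumped uncertainty. -/
def IsISS (S : Set (Fin nx → ℝ)) : Prop :=
  IsCompact S ∧ 0 ∈ interior S ∧ P.RobustInvariant μ S ∧ P.ISSEstimate μ S

/-- `V` is a (dissipative-form) ISS-Lyapunov function for the closed loop on `S`. As `V` may be
infinite outside `S`, the dissipation inequality `V(x⁺) - V(x) ≤ -α₃(‖x‖) + σ(‖η‖)` is written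
without subtraction; both bounds together say that all its terms are finite. -/
def IsISSLyapunov (V : (Fin nx → ℝ) → ℝ≥0∞) (S : Set (Fin nx → ℝ)) : Prop :=
  ∃ α₁ α₂ α₃ σ : ℝ≥0 → ℝ≥0,
    IsClassKInf α₁ ∧ IsClassKInf α₂ ∧ IsClassKInf α₃ ∧ IsClassK σ ∧
    (∀ x ∈ S, (α₁ ‖x‖₊ : ℝ≥0∞) ≤ V x ∧ V x ≤ (α₂ ‖x‖₊ : ℝ≥0∞)) ∧
    ∀ x ∈ S, ∀ k, ∀ ΔA ∈ P.setPA, ∀ ΔB ∈ P.setPB, ∀ w ∈ P.setW,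
      V (P.succ x (μ k x) (lumped ΔA ΔB x (μ k x) w)) + (α₃ ‖x‖₊ : ℝ≥0∞)
        ≤ V x + (σ ‖lumped ΔA ΔB x (μ k x) w‖₊ : ℝ≥0∞)

end RobustMPC

/-!
The optimal cost `J` of the robust MPC problem is a quadratic Lyapunov function for the closed loop.
A feasible system response is used only through its nominal trajectory and its responses to the
normalized disturbances (`IsResponse`); conversely such data come from a feasible system response
as soon as the nominal inputs are linear images of the initial state, which is automatic if that
state is nonzero (`Feasible.exists_isResponse`, `IsResponse.exists_feasible`). At the state zero the
local controller is feasible and the value is zero.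

*Terminal set.* Matrices of induced `ℓ_∞` norm at most `ε` map `x` onto the whole ball of radius
`ε ‖x‖`, so robust invariance of the terminal set under the local controller is exactly the
tightened terminal constraint for the horizon one. Hence the terminal set is feasible, and there `J`
is at most the terminal cost (`exists_feasible_of_mem_terminalSet`).

*Decrease.* The lumped uncertainty `η` has norm at most `σ 0`, hence is `σ 0 • ω` with `‖ω‖ ≤ 1`.
If the optimal horizon is greater than one, the optimal response with its first disturbance fixed
to `ω` and shifted by one step is a response for the next state and the horizon shortened by one.
If it is one, the next state is in the terminal set. In both cases the cost exceeds the remaining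
nominal cost by at most a multiple of `‖η‖`, since all responses are bounded by compactness of the
constraint sets and `σ 0` is at least the disturbance bound (`exists_valueFn_succ_le`). Thus the
whole feasible set is robust forward invariant, and `J(x⁺) - J(x) ≤ - xᵀ Q x + L ‖η‖` on it.

*Bounds.* `J(x) ≥ xᵀ Q x` is clear; `J(x) ≤ b ‖x‖²` holds near the origin by the terminal cost and
elsewhere because `J` is bounded on the feasible set (`exists_valueFn_le_mul_sq`). Quadratic bounds
and linear gain give a geometric decay, hence the ISS estimate (`QuadraticLyapunov.issEstimate`).

*Compactness.* Up to irrelevant entries the responses for a given horizon form a compact set, which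
gives the existence of optimal solutions (`Feasible.exists_isOptimal`) and the compactness of the
feasible set (`isCompact_feasibleSet`).

The claims on the region of attraction follow by restriction, as it lies between the terminal set
and the feasible set.
-/

/-! ### Induced norms, `ℓ₁` norms and quadratic forms -/

lemma indNorm_nonneg {m n : ℕ} (M : Matrix (Fin m) (Fin n) ℝ) : 0 ≤ indNorm M := norm_nonneg _

lemma norm_mulVec_le_indNorm_mul {m n : ℕ} (M : Matrix (Fin m) (Fin n) ℝ) (v : Fin n → ℝ) :
    ‖M *ᵥ v‖ ≤ indNorm M * ‖v‖ :=
  (LinearMap.toContinuousLinearMap (Matrix.toLin' M)).le_opNorm v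

lemma norm_mulVec_le_of_indNorm_le {m n : ℕ} {M : Matrix (Fin m) (Fin n) ℝ} {c : ℝ}
    (h : indNorm M ≤ c) (v : Fin n → ℝ) : ‖M *ᵥ v‖ ≤ c * ‖v‖ :=
  (norm_mulVec_le_indNorm_mul M v).trans (mul_le_mul_of_nonneg_right h (norm_nonneg v))

lemma indNorm_le_of_forall_norm_le_mul {m n : ℕ} {M : Matrix (Fin m) (Fin n) ℝ} {c : ℝ}
    (hc : 0 ≤ c) (h : ∀ v, ‖M *ᵥ v‖ ≤ c * ‖v‖) : indNorm M ≤ c :=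
  ContinuousLinearMap.opNorm_le_bound _ hc h

lemma indNorm_le_of_forall_unit {m n : ℕ} {M : Matrix (Fin m) (Fin n) ℝ} {c : ℝ}
    (hc : 0 ≤ c) (h : ∀ v, ‖v‖ ≤ 1 → ‖M *ᵥ v‖ ≤ c) : indNorm M ≤ c := by
  refine indNorm_le_of_forall_norm_le_mul hc fun v => ?_
  rcases eq_or_ne v 0 with rfl | hv
  · simp
  have hv' : 0 < ‖v‖ := norm_pos_iff.2 hv
  have := h (‖v‖⁻¹ • v) (by rw [norm_smul, norm_inv, norm_norm, inv_mul_cancel₀ hv'.ne'])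
  rw [Matrix.mulVec_smul, norm_smul, norm_inv, norm_norm, inv_mul_le_iff₀ hv'] at this
  linarith

@[simp] lemma indNorm_zero {m n : ℕ} : indNorm (0 : Matrix (Fin m) (Fin n) ℝ) = 0 := by
  simp [indNorm]

@[simp] lemma l1Norm_zero {n : ℕ} : l1Norm (0 : Fin n → ℝ) = 0 := by simp [l1Norm]

lemma l1Norm_nonneg {n : ℕ} (f : Fin n → ℝ) : 0 ≤ l1Norm f :=
  Finset.sum_nonneg fun _ _ => abs_nonneg _

lemma l1Norm_smul {n : ℕ} (c : ℝ) (f : Fin n → ℝ) : l1Norm (c • f) = |c| * l1Norm f := by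
  simp [l1Norm, Finset.mul_sum, abs_mul]

lemma abs_entry_le_indNorm {m n : ℕ} (M : Matrix (Fin m) (Fin n) ℝ) (a : Fin m) (b : Fin n) :
    |M a b| ≤ indNorm M := by
  have h1 := norm_mulVec_le_indNorm_mul M (Pi.single b 1)
  have h2 := norm_le_pi_norm (M *ᵥ Pi.single b 1) a
  have h3 : ‖(Pi.single b 1 : Fin n → ℝ)‖ ≤ 1 := by
    refine (pi_norm_le_iff_of_nonneg zero_le_one).2 fun i => ?_
    by_cases h : i = b
    · subst h; simp
    · simp [h]
  simp only [Matrix.mulVec_single_one, Real.norm_eq_abs, Matrix.col_apply] at h1 h2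
  exact h2.trans (h1.trans (mul_le_of_le_one_right (indNorm_nonneg M) h3))

lemma continuous_indNorm {m n : ℕ} :
    Continuous (indNorm : Matrix (Fin m) (Fin n) ℝ → ℝ) := by
  have : Continuous ((LinearMap.toContinuousLinearMap (𝕜 := ℝ) (E := Fin n → ℝ)
      (F' := Fin m → ℝ)).toLinearMap ∘ₗ (Matrix.toLin' (R := ℝ)).toLinearMap) :=
    LinearMap.continuous_of_finiteDimensional _
  exact this.norm

lemma continuous_l1Norm {n : ℕ} : Continuous (l1Norm : (Fin n → ℝ) → ℝ) := by
  unfold l1Norm; fun_prop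

lemma abs_dotProduct_le_l1Norm_mul {n : ℕ} (f v : Fin n → ℝ) : |f ⬝ᵥ v| ≤ l1Norm f * ‖v‖ := by
  rw [l1Norm, Finset.sum_mul]
  refine (Finset.abs_sum_le_sum_abs _ _).trans (Finset.sum_le_sum fun i _ => ?_)
  rw [abs_mul]
  exact mul_le_mul_of_nonneg_left (norm_le_pi_norm v i) (abs_nonneg _)

/-- Duality: the `ℓ₁` norm is the value of the functional at some point of the unit `ℓ_∞` ball. -/
lemma exists_dotProduct_eq_l1Norm {n : ℕ} (f : Fin n → ℝ) :
    ∃ v : Fin n → ℝ, ‖v‖ ≤ 1 ∧ f ⬝ᵥ v = l1Norm f := by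
  refine ⟨fun i => SignType.sign (f i), (pi_norm_le_iff_of_nonneg zero_le_one).2 fun i => ?_, ?_⟩
  · rcases lt_trichotomy (f i) 0 with h | h | h <;> simp [h]
  · simp [dotProduct, l1Norm]

/-- For the induced `ℓ_∞` norm, any vector of norm at most `ε ‖x‖` is the image of `x` under a
matrix of norm at most `ε`, which reads off a coordinate where `x` attains its norm. -/
lemma exists_indNorm_le_mulVec_eq {m n : ℕ} {ε : ℝ} (hε : 0 ≤ ε) (x : Fin n → ℝ) (v : Fin m → ℝ)
    (hv : ‖v‖ ≤ ε * ‖x‖) : ∃ Δ : Matrix (Fin m) (Fin n) ℝ, indNorm Δ ≤ ε ∧ Δ *ᵥ x = v := by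
  rcases eq_or_ne x 0 with rfl | hx
  · refine ⟨0, by simpa using hε, ?_⟩
    have : ‖v‖ ≤ 0 := by simpa using hv
    simp [norm_le_zero_iff.1 this]
  have : Nonempty (Fin n) := by
    by_contra h
    rw [not_nonempty_iff] at h
    exact hx (Subsingleton.elim _ _)
  obtain ⟨j, hmax⟩ := Finite.exists_max fun i => ‖x i‖
  have hj : ‖x j‖ = ‖x‖ :=
    (norm_le_pi_norm x j).antisymm ((pi_norm_le_iff_of_nonneg (norm_nonneg _)).2 hmax)
  have hx' : 0 < ‖x‖ := norm_pos_iff.2 hx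
  have hxj : x j ≠ 0 := by
    intro h
    rw [h, norm_zero] at hj
    exact hx'.ne hj
  refine ⟨Matrix.vecMulVec ((x j)⁻¹ • v) (Pi.single j 1), ?_, ?_⟩
  · refine indNorm_le_of_forall_norm_le_mul hε fun y => ?_
    rw [Matrix.vecMulVec_mulVec, single_one_dotProduct, op_smul_eq_smul, smul_smul, norm_smul,
      norm_mul, norm_inv, hj]
    calc ‖y j‖ * ‖x‖⁻¹ * ‖v‖ ≤ ‖y‖ * ‖x‖⁻¹ * (ε * ‖x‖) := by
          gcongr; exact norm_le_pi_norm y j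
      _ = ε * ‖y‖ := by field_simp
  · rw [Matrix.vecMulVec_mulVec, single_one_dotProduct, op_smul_eq_smul, smul_smul,
      mul_inv_cancel₀ hxj, one_smul]

lemma exists_mulVec_eq_of_ne_zero {m n : ℕ} {x : Fin n → ℝ} (hx : x ≠ 0) (v : Fin m → ℝ) :
    ∃ G : Matrix (Fin m) (Fin n) ℝ, v = G *ᵥ x := by
  have hx' : 0 < ‖x‖ := norm_pos_iff.2 hx
  obtain ⟨G, -, hG⟩ := exists_indNorm_le_mulVec_eq (ε := ‖v‖ / ‖x‖) (by positivity) x v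
    (by rw [div_mul_cancel₀ _ hx'.ne'])
  exact ⟨G, hG.symm⟩

/-- The quadratic form `y ↦ yᵀ M y`. -/
def quadForm {n : ℕ} (M : Matrix (Fin n) (Fin n) ℝ) (y : Fin n → ℝ) : ℝ := y ⬝ᵥ (M *ᵥ y)

@[simp] lemma quadForm_zero {n : ℕ} (M : Matrix (Fin n) (Fin n) ℝ) : quadForm M 0 = 0 := by
  simp [quadForm]

lemma continuous_quadForm {n : ℕ} (M : Matrix (Fin n) (Fin n) ℝ) : Continuous (quadForm M) := by
  unfold quadForm; fun_prop

lemma quadForm_smul {n : ℕ} (M : Matrix (Fin n) (Fin n) ℝ) (c : ℝ) (y : Fin n → ℝ) :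
    quadForm M (c • y) = c ^ 2 * quadForm M y := by
  simp only [quadForm, Matrix.mulVec_smul, dotProduct_smul, smul_dotProduct, smul_eq_mul]; ring

lemma Matrix.PosDef.quadForm_nonneg {n : ℕ} {M : Matrix (Fin n) (Fin n) ℝ} (hM : M.PosDef)
    (y : Fin n → ℝ) : 0 ≤ quadForm M y := by
  rcases eq_or_ne y 0 with rfl | hy
  · simp
  · simpa [quadForm] using (hM.dotProduct_mulVec_pos hy).le

lemma exists_abs_bilinear_le {n : ℕ} (M : Matrix (Fin n) (Fin n) ℝ) :
    ∃ S : ℝ, 0 ≤ S ∧ ∀ y z : Fin n → ℝ, |y ⬝ᵥ (M *ᵥ z)| ≤ S * ‖y‖ * ‖z‖ := by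
  refine ⟨n * indNorm M, mul_nonneg n.cast_nonneg (indNorm_nonneg M), fun y z => ?_⟩
  have hy : l1Norm y ≤ n * ‖y‖ := by
    have := Finset.sum_le_card_nsmul Finset.univ (fun i => |y i|) ‖y‖
      fun i _ => norm_le_pi_norm y i
    simpa [l1Norm] using this
  calc |y ⬝ᵥ (M *ᵥ z)| ≤ l1Norm y * ‖M *ᵥ z‖ := abs_dotProduct_le_l1Norm_mul _ _
    _ ≤ (n * ‖y‖) * (indNorm M * ‖z‖) := by
        gcongr
        exact norm_mulVec_le_indNorm_mul M z
    _ = n * indNorm M * ‖y‖ * ‖z‖ := by ring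

lemma exists_quadForm_le {n : ℕ} (M : Matrix (Fin n) (Fin n) ℝ) (C : ℝ) :
    ∃ S : ℝ, 0 ≤ S ∧ ∀ y : Fin n → ℝ, ‖y‖ ≤ C → quadForm M y ≤ S := by
  obtain ⟨S, hS, h⟩ := exists_abs_bilinear_le M
  refine ⟨S * |C| * |C|, by positivity, fun y hy => (le_abs_self _).trans ((h y y).trans ?_)⟩
  have := hy.trans (le_abs_self C)
  gcongr

lemma exists_quadForm_le_mul_sq {n : ℕ} (M : Matrix (Fin n) (Fin n) ℝ) :
    ∃ S : ℝ, 0 ≤ S ∧ ∀ y : Fin n → ℝ, quadForm M y ≤ S * ‖y‖ ^ 2 := by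
  obtain ⟨S, hS, h⟩ := exists_abs_bilinear_le M
  exact ⟨S, hS, fun y => (le_abs_self _).trans ((h y y).trans_eq (by ring))⟩

/-- Quadratic forms are Lipschitz on bounded sets. -/
lemma exists_quadForm_le_add {n : ℕ} (M : Matrix (Fin n) (Fin n) ℝ) (C : ℝ) :
    ∃ L : ℝ, 0 ≤ L ∧ ∀ y z : Fin n → ℝ, ‖y‖ ≤ C → ‖z‖ ≤ C →
      quadForm M y ≤ quadForm M z + L * ‖y - z‖ := by
  obtain ⟨S, hS, h⟩ := exists_abs_bilinear_le M
  refine ⟨2 * S * |C|, by positivity, fun y z hy hz => ?_⟩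
  have hy := hy.trans (le_abs_self C)
  have hz := hz.trans (le_abs_self C)
  have h0 : quadForm M y - quadForm M z = (y - z) ⬝ᵥ (M *ᵥ y) + z ⬝ᵥ (M *ᵥ (y - z)) := by
    simp only [quadForm, Matrix.mulVec_sub, sub_dotProduct, dotProduct_sub]; ring
  have h1 : (y - z) ⬝ᵥ (M *ᵥ y) ≤ S * ‖y - z‖ * |C| :=
    (le_abs_self _).trans ((h _ _).trans (by gcongr))
  have h2 : z ⬝ᵥ (M *ᵥ (y - z)) ≤ S * |C| * ‖y - z‖ :=
    (le_abs_self _).trans ((h _ _).trans (by gcongr))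
  linarith

lemma Matrix.PosDef.exists_mul_sq_le_quadForm {n : ℕ} {M : Matrix (Fin n) (Fin n) ℝ}
    (hM : M.PosDef) : ∃ c : ℝ, 0 < c ∧ ∀ y : Fin n → ℝ, c * ‖y‖ ^ 2 ≤ quadForm M y := by
  rcases (Metric.sphere (0 : Fin n → ℝ) 1).eq_empty_or_nonempty with he | hne
  · refine ⟨1, one_pos, fun y => ?_⟩
    have hy : y = 0 := by
      by_contra hy
      have : ‖y‖⁻¹ • y ∈ Metric.sphere (0 : Fin n → ℝ) 1 := by
        simp [norm_smul, inv_mul_cancel₀ (norm_ne_zero_iff.2 hy)]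
      rw [he] at this
      exact this
    simp [hy]
  · obtain ⟨z, hz, hmin⟩ := (isCompact_sphere (0 : Fin n → ℝ) 1).exists_isMinOn hne
      (continuous_quadForm M).continuousOn
    have hz0 : z ≠ 0 := by
      rintro rfl
      simp at hz
    refine ⟨quadForm M z, by simpa [quadForm] using hM.dotProduct_mulVec_pos hz0, fun y => ?_⟩
    rcases eq_or_ne y 0 with rfl | hy
    · simp
    have hy' : 0 < ‖y‖ := norm_pos_iff.2 hy
    have : ‖y‖⁻¹ • y ∈ Metric.sphere (0 : Fin n → ℝ) 1 := by
      simp [norm_smul, inv_mul_cancel₀ hy'.ne']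
    have h := isMinOn_iff.1 hmin _ this
    rw [quadForm_smul, inv_pow, ← div_eq_inv_mul, le_div_iff₀ (by positivity)] at h
    exact h

/-! ### Block form of the system-level constraints -/

@[simp] lemma HorizonMatrix.block_apply {T p q : ℕ} (Φ : HorizonMatrix T p q) (i j : Fin (T + 1))
    (a : Fin p) (b : Fin q) : Φ.block i j a b = Φ (a, i) (b, j) := rfl

lemma HorizonMatrix.ext_block {T p q : ℕ} {Φ Ψ : HorizonMatrix T p q}
    (h : ∀ i j, Φ.block i j = Ψ.block i j) : Φ = Ψ := by
  ext ⟨a, i⟩ ⟨b, j⟩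
  exact congrFun₂ (h i j) a b

lemma downshift_mul_stackMatrix_apply {T n q : ℕ} (M : Matrix (Fin n) (Fin q) ℝ) (a : Fin n)
    (b : Fin q) (i j : Fin (T + 1)) :
    (downshift T n * stackMatrix T M) (a, i) (b, j) = if (i : ℕ) = j + 1 then M a b else 0 := by
  simp only [Matrix.mul_apply, downshift, stackMatrix, Matrix.blockDiagonal_apply,
    Fintype.sum_prod_type, Matrix.of_apply]
  rw [Finset.sum_eq_single a, Finset.sum_eq_single j]
  · by_cases h : (i : ℕ) = j + 1
    · have hj : j ≠ Fin.last T := by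
        rintro rfl
        have := i.isLt
        simp only [Fin.val_last] at h
        omega
      simp [h, hj]
    · simp [h]
  · intro k _ hk
    simp [hk]
  · simp
  · intro c _ hc
    simp [hc.symm]
  · simp

lemma block_zero_downshift_mul {T n q p : ℕ} (M : Matrix (Fin n) (Fin q) ℝ)
    (Φ : HorizonMatrix T q p) (j : Fin (T + 1)) :
    HorizonMatrix.block (downshift T n * stackMatrix T M * Φ) 0 j = 0 := by
  ext a b
  rw [HorizonMatrix.block_apply, Matrix.mul_apply, Fintype.sum_prod_type]
  simp [downshift_mul_stackMatrix_apply]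

lemma block_succ_downshift_mul {T n q p : ℕ} (M : Matrix (Fin n) (Fin q) ℝ)
    (Φ : HorizonMatrix T q p) (t : Fin T) (j : Fin (T + 1)) :
    HorizonMatrix.block (downshift T n * stackMatrix T M * Φ) t.succ j
      = M * Φ.block t.castSucc j := by
  ext a b
  rw [HorizonMatrix.block_apply, Matrix.mul_apply, Fintype.sum_prod_type, Matrix.mul_apply]
  refine Finset.sum_congr rfl fun c _ => ?_
  rw [Finset.sum_eq_single t.castSucc]
  · simp [downshift_mul_stackMatrix_apply]
  · intro k _ hk
    have : ¬ ((t : ℕ) = k) := fun h => hk (Fin.ext h.symm)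
    simp [downshift_mul_stackMatrix_apply, this]
  · simp

lemma block_noiseFilter_zero {T n : ℕ} (σ : Fin T → ℝ) (j : Fin (T + 1)) :
    HorizonMatrix.block (noiseFilter n σ) 0 j = if j = 0 then 1 else 0 := by
  ext a b
  rcases eq_or_ne j 0 with rfl | h
  · simp [noiseFilter, Matrix.blockDiagonal_apply]
  · simp [noiseFilter, Matrix.blockDiagonal_apply, h, h.symm]

lemma block_noiseFilter_succ {T n : ℕ} (σ : Fin T → ℝ) (t : Fin T) (j : Fin (T + 1)) :
    HorizonMatrix.block (noiseFilter n σ) t.succ j = if t.succ = j then σ t • 1 else 0 := by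
  ext a b
  by_cases h : t.succ = j
  · subst h
    simp [noiseFilter, Matrix.blockDiagonal_apply]
  · simp [noiseFilter, Matrix.blockDiagonal_apply, h]

/-- The affine constraint says that each block column of the responses is a trajectory of the
nominal system. -/
lemma affine_iff {T nx nu : ℕ} (A : Matrix (Fin nx) (Fin nx) ℝ) (B : Matrix (Fin nx) (Fin nu) ℝ)
    (Φx : HorizonMatrix T nx nx) (Φu : HorizonMatrix T nu nx) (σ : Fin T → ℝ) :
    (1 - downshift T nx * stackMatrix T A) * Φx - (downshift T nx * stackMatrix T B) * Φu
        = noiseFilter nx σ ↔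
      (∀ j, Φx.block 0 j = if j = 0 then 1 else 0) ∧
      ∀ (t : Fin T) (j : Fin (T + 1)), Φx.block t.succ j = A * Φx.block t.castSucc j
        + B * Φu.block t.castSucc j + if t.succ = j then σ t • 1 else 0 := by
  have key : ∀ i j, HorizonMatrix.block
      ((1 - downshift T nx * stackMatrix T A) * Φx - (downshift T nx * stackMatrix T B) * Φu) i j
      = Φx.block i j - HorizonMatrix.block (downshift T nx * stackMatrix T A * Φx) i j
        - HorizonMatrix.block (downshift T nx * stackMatrix T B * Φu) i j := by
    intro i j
    rw [Matrix.sub_mul, Matrix.one_mul]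
    rfl
  constructor
  · intro h
    refine ⟨fun j => ?_, fun t j => ?_⟩
    · have := key 0 j
      rw [h, block_noiseFilter_zero, block_zero_downshift_mul, block_zero_downshift_mul] at this
      simpa using this.symm
    · have := key t.succ j
      rw [h, block_noiseFilter_succ, block_succ_downshift_mul, block_succ_downshift_mul] at this
      rw [this]
      abel
  · rintro ⟨h0, h1⟩
    refine HorizonMatrix.ext_block fun i j => ?_
    rw [key]
    refine Fin.cases ?_ (fun t => ?_) i
    · rw [block_noiseFilter_zero, block_zero_downshift_mul, block_zero_downshift_mul, h0]
      simp
    · rw [block_noiseFilter_succ, block_succ_downshift_mul, block_succ_downshift_mul, h1]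
      abel

lemma sum_Ioc_zero_eq_sum_range {T : ℕ} (t : Fin (T + 1)) (f : Fin (T + 1) → ℝ) (g : ℕ → ℝ)
    (h : ∀ i : Fin T, (i : ℕ) < t → g i = f i.succ) :
    ∑ i ∈ Finset.Ioc 0 t, f i = ∑ i ∈ Finset.range t, g i := by
  symm
  refine Finset.sum_bij (fun i hi => (⟨i + 1, ?_⟩ : Fin (T + 1))) ?_ ?_ ?_ ?_
  · have := Finset.mem_range.1 hi
    omega
  · intro i hi
    have := Finset.mem_range.1 hi
    simp only [Finset.mem_Ioc, Fin.lt_def, Fin.le_def, Fin.val_zero]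
    omega
  · intro i _ j _ hij
    simpa using hij
  · intro i hi
    simp only [Finset.mem_Ioc, Fin.lt_def, Fin.le_def, Fin.val_zero] at hi
    exact ⟨i - 1, Finset.mem_range.2 (by omega), Fin.ext (by simp; omega)⟩
  · intro i hi
    have := Finset.mem_range.1 hi
    exact h ⟨i, by omega⟩ this

/-! ### Responses indexed by natural numbers -/

/-- The tightened constraint for a signal with nominal value `y t` and response `Y t i` at time
`t` to the normalized disturbance that acts at time `i`. -/
def TightenedResponse {m p q : ℕ} (F : Matrix (Fin m) (Fin p) ℝ) (b : Fin m → ℝ)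
    (y : ℕ → Fin p → ℝ) (Y : ℕ → ℕ → Matrix (Fin p) (Fin q) ℝ) (t : ℕ) : Prop :=
  ∀ r, F r ⬝ᵥ y t + ∑ i ∈ Finset.range t, l1Norm (F r ᵥ* Y t i) ≤ b r

/-- The bound on the size at time `t` of the signal with nominal value `y` and disturbance
response `Y`. -/
noncomputable def signalBound {p q : ℕ} (y : ℕ → Fin p → ℝ)
    (Y : ℕ → ℕ → Matrix (Fin p) (Fin q) ℝ) (t : ℕ) : ℝ :=
  ‖y t‖ + ∑ i ∈ Finset.range t, indNorm (Y t i)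

namespace RobustMPC

variable {nx nu : ℕ} (P : RobustMPC nx nu)

/-- The constraints of the program with horizon `T`, in terms of the nominal trajectory `x`, `u`
and the responses `X t i`, `U t i` at time `t` to the normalized disturbance entering between the
times `i` and `i + 1`. The initial state is `x 0`. Only the values `x t`, `X t i` with
`i < t ≤ T`, `u t`, `U t i` with `i < t < T` and `σ t` with `t < T` matter. Unlike in the
original program, `u` is not required to be linear in `x 0`. -/
structure IsResponse (T : ℕ) (x : ℕ → Fin nx → ℝ) (u : ℕ → Fin nu → ℝ)
    (X : ℕ → ℕ → Matrix (Fin nx) (Fin nx) ℝ) (U : ℕ → ℕ → Matrix (Fin nu) (Fin nx) ℝ)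
    (σ : ℕ → ℝ) : Prop where
  nominal : ∀ t < T, x (t + 1) = P.A *ᵥ x t + P.B *ᵥ u t
  diag : ∀ t < T, X (t + 1) t = σ t • 1
  step : ∀ t < T, ∀ i < t, X (t + 1) i = P.A * X t i + P.B * U t i
  noise_bound : ∀ t < T, P.εA * signalBound x X t + P.εB * signalBound u U t + P.σw ≤ σ t
  state : ∀ t < T, TightenedResponse P.FX P.bX x X t
  input : ∀ t < T, TightenedResponse P.FU P.bU u U t
  terminal : TightenedResponse P.FT P.bT x X T

/-- The cost of a nominal trajectory. -/
def trajCost (T : ℕ) (x : ℕ → Fin nx → ℝ) (u : ℕ → Fin nu → ℝ) : ℝ :=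
  ∑ t ∈ Finset.range T, (quadForm P.Q (x t) + quadForm P.R (u t)) + quadForm P.QT (x T)

end RobustMPC

/-- The nominal signal of `Φ` for the initial state `x₀`. Times beyond the horizon wrap around. -/
def HorizonMatrix.nominal {T p q : ℕ} (Φ : HorizonMatrix T p q) (x₀ : Fin q → ℝ) (t : ℕ) :
    Fin p → ℝ :=
  Φ.block (Fin.ofNat (T + 1) t) 0 *ᵥ x₀

/-- The response of `Φ` at time `t` to the disturbance `i`, which sits in block column `i + 1`.
Times beyond the horizon wrap around. -/
def HorizonMatrix.response {T p q : ℕ} (Φ : HorizonMatrix T p q) (t i : ℕ) :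
    Matrix (Fin p) (Fin q) ℝ :=
  Φ.block (Fin.ofNat (T + 1) t) (Fin.ofNat (T + 1) (i + 1))

lemma Fin.ofNat_val_self {T : ℕ} (t : Fin (T + 1)) : Fin.ofNat (T + 1) t = t := by
  ext; simp

lemma Fin.ofNat_val_succ {T : ℕ} (t : Fin T) : Fin.ofNat (T + 1) (t + 1) = t.succ :=
  Fin.ofNat_val_self t.succ

lemma tightenedResponse_iff {T m p q : ℕ} (F : Matrix (Fin m) (Fin p) ℝ) (b : Fin m → ℝ)
    (Φ : HorizonMatrix T p q) (x₀ : Fin q → ℝ) (y : ℕ → Fin p → ℝ)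
    (Y : ℕ → ℕ → Matrix (Fin p) (Fin q) ℝ) (t : Fin (T + 1))
    (hy : y t = Φ.block t 0 *ᵥ x₀) (hY : ∀ i : Fin T, (i : ℕ) < t → Y t i = Φ.block t i.succ) :
    TightenedResponse F b y Y t ↔ Tightened F b Φ x₀ t := by
  refine forall_congr' fun r => ?_
  rw [hy, sum_Ioc_zero_eq_sum_range t _ (fun i => l1Norm (F r ᵥ* Y t i))
    fun i hi => by simp only [hY i hi]]

lemma signalBound_eq {T p q : ℕ} (Φ : HorizonMatrix T p q) (x₀ : Fin q → ℝ) (y : ℕ → Fin p → ℝ)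
    (Y : ℕ → ℕ → Matrix (Fin p) (Fin q) ℝ) (t : Fin (T + 1))
    (hy : y t = Φ.block t 0 *ᵥ x₀) (hY : ∀ i : Fin T, (i : ℕ) < t → Y t i = Φ.block t i.succ) :
    signalBound y Y t = responseBound Φ x₀ t := by
  rw [signalBound, responseBound, hy, sum_Ioc_zero_eq_sum_range t _ (fun i => indNorm (Y t i))
    fun i hi => by simp only [hY i hi]]

namespace RobustMPC

variable {nx nu : ℕ} {P : RobustMPC nx nu}

/-- The cost of the program is the cost of its nominal trajectory. -/
lemma cost_eq_trajCost {T : ℕ} {s : SLSVar T nx nu} {x₀ : Fin nx → ℝ} {x : ℕ → Fin nx → ℝ}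
    {u : ℕ → Fin nu → ℝ} (hx : ∀ t : Fin (T + 1), x t = s.Φx.block t 0 *ᵥ x₀)
    (hu : ∀ t : Fin T, u t = s.Φu.block t.castSucc 0 *ᵥ x₀) :
    P.cost T x₀ s = P.trajCost T x u := by
  rw [cost, trajCost, Finset.sum_range]
  have := hx (Fin.last T)
  simp only [Fin.val_last] at this
  rw [this]
  congr 1
  refine Finset.sum_congr rfl fun t _ => ?_
  have := hx t.castSucc
  simp only [Fin.val_castSucc] at this
  rw [this, hu]
  rfl

/-- Every feasible system response is a response in the sense of `IsResponse`. -/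
lemma Feasible.exists_isResponse {T : ℕ} {x₀ : Fin nx → ℝ} {s : SLSVar T nx nu}
    (h : P.Feasible T x₀ s) : ∃ x u X U σ, P.IsResponse T x u X U σ ∧ x 0 = x₀ ∧
      u 0 = s.Φu.block 0 0 *ᵥ x₀ ∧ P.cost T x₀ s = P.trajCost T x u := by
  obtain ⟨h0, h1⟩ := (affine_iff _ _ _ _ _).1 h.affine
  have hx : ∀ t : Fin (T + 1), s.Φx.nominal x₀ t = s.Φx.block t 0 *ᵥ x₀ := fun t => by
    rw [HorizonMatrix.nominal, Fin.ofNat_val_self]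
  have hu : ∀ t : Fin (T + 1), s.Φu.nominal x₀ t = s.Φu.block t 0 *ᵥ x₀ := fun t => by
    rw [HorizonMatrix.nominal, Fin.ofNat_val_self]
  have hX : ∀ (t : Fin (T + 1)) (i : Fin T), s.Φx.response t i = s.Φx.block t i.succ :=
    fun t i => by rw [HorizonMatrix.response, Fin.ofNat_val_self, Fin.ofNat_val_succ]
  have hU : ∀ (t : Fin (T + 1)) (i : Fin T), s.Φu.response t i = s.Φu.block t i.succ :=
    fun t i => by rw [HorizonMatrix.response, Fin.ofNat_val_self, Fin.ofNat_val_succ]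
  refine ⟨s.Φx.nominal x₀, s.Φu.nominal x₀, s.Φx.response, s.Φu.response,
    fun t => if ht : t < T then s.σ ⟨t, ht⟩ else 0, ?_, ?_, hu 0,
    cost_eq_trajCost hx fun t => hu t.castSucc⟩
  · constructor
    · intro t ht
      lift t to Fin T using ht
      have := hx t.succ
      rw [Fin.val_succ] at this
      rw [this, ← Fin.val_castSucc, hx, hu, h1]
      simp [Matrix.add_mulVec, Matrix.mulVec_mulVec, (Fin.succ_ne_zero t)]
    · intro t ht
      lift t to Fin T using ht
      have := hX t.succ t
      rw [Fin.val_succ] at this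
      rw [this, h1, h.causal_x _ _ (Fin.castSucc_lt_succ), h.causal_u _ _ (Fin.castSucc_lt_succ)]
      simp
    · intro t ht i hi
      lift i to Fin T using hi.trans ht
      lift t to Fin T using ht
      have h2 := hX t.succ i
      have h3 := hX t.castSucc i
      have h4 := hU t.castSucc i
      rw [Fin.val_succ] at h2
      rw [Fin.val_castSucc] at h3 h4
      have : t.succ ≠ i.succ := by
        intro h
        rw [Fin.succ_inj.1 h] at hi
        exact lt_irrefl _ hi
      rw [h2, h3, h4, h1]
      simp [this]
    · intro t ht
      have := h.noise_bound ⟨t, ht⟩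
      rw [← signalBound_eq s.Φx x₀ (s.Φx.nominal x₀) s.Φx.response _ (hx _) fun i _ => hX _ i,
        ← signalBound_eq s.Φu x₀ (s.Φu.nominal x₀) s.Φu.response _ (hu _) fun i _ => hU _ i] at this
      simpa [ht] using this
    · intro t ht
      exact (tightenedResponse_iff _ _ _ x₀ _ _ (Fin.castSucc ⟨t, ht⟩) (hx _)
        fun i _ => hX _ i).2 (h.state ⟨t, ht⟩)
    · intro t ht
      exact (tightenedResponse_iff _ _ _ x₀ _ _ (Fin.castSucc ⟨t, ht⟩) (hu _)
        fun i _ => hU _ i).2 (h.input ⟨t, ht⟩)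
    · exact (tightenedResponse_iff _ _ _ x₀ _ _ (Fin.last T) (hx _)
        fun i _ => hX _ i).2 h.terminal
  · have := hx 0
    rw [h0] at this
    simpa using this

end RobustMPC

/-- The causal operator with first block column `G` and response `Y t i` at time `t` to the
disturbance `i`. -/
def HorizonMatrix.ofResponse (T : ℕ) {p q : ℕ} (G : ℕ → Matrix (Fin p) (Fin q) ℝ)
    (Y : ℕ → ℕ → Matrix (Fin p) (Fin q) ℝ) : HorizonMatrix T p q :=
  Matrix.of fun a b => if (b.2 : ℕ) = 0 then G a.2 a.1 b.1
    else if b.2 ≤ a.2 then Y a.2 (b.2 - 1) a.1 b.1 else 0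

namespace HorizonMatrix

variable {T p q : ℕ} (G : ℕ → Matrix (Fin p) (Fin q) ℝ) (Y : ℕ → ℕ → Matrix (Fin p) (Fin q) ℝ)

lemma block_ofResponse_zero (t : Fin (T + 1)) : (ofResponse T G Y).block t 0 = G t := by
  ext a b; simp [ofResponse]

lemma block_ofResponse_succ (t : Fin (T + 1)) (i : Fin T) :
    (ofResponse T G Y).block t i.succ = if (i : ℕ) < t then Y t i else 0 := by
  ext a b
  by_cases h : (i : ℕ) < t
  · have : i.succ ≤ t := by rw [Fin.le_def, Fin.val_succ]; omega
    simp [ofResponse, h, this]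
  · have : ¬ i.succ ≤ t := by rw [Fin.le_def, Fin.val_succ]; omega
    simp [ofResponse, h, this]

lemma isCausal_ofResponse : (ofResponse T G Y).IsCausal := by
  intro t j
  refine Fin.cases (fun h => absurd h (Fin.not_lt_zero _)) (fun i h => ?_) j
  rw [block_ofResponse_succ, if_neg]
  rw [Fin.lt_def, Fin.val_succ] at h
  omega

end HorizonMatrix

namespace RobustMPC

variable {nx nu : ℕ} {P : RobustMPC nx nu}

/-- Conversely, a response whose nominal inputs are linear images of the initial state comes from
a feasible system response. -/
lemma IsResponse.exists_feasible {T : ℕ} {x : ℕ → Fin nx → ℝ} {u : ℕ → Fin nu → ℝ}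
    {X : ℕ → ℕ → Matrix (Fin nx) (Fin nx) ℝ} {U : ℕ → ℕ → Matrix (Fin nu) (Fin nx) ℝ}
    {σ : ℕ → ℝ} (h : P.IsResponse T x u X U σ)
    (hlin : ∀ t, ∃ G : Matrix (Fin nu) (Fin nx) ℝ, u t = G *ᵥ x 0) :
    ∃ s : SLSVar T nx nu, P.Feasible T (x 0) s ∧ P.cost T (x 0) s = P.trajCost T x u := by
  choose G hG using hlin
  set H : ℕ → Matrix (Fin nx) (Fin nx) ℝ :=
    fun t => Nat.rec 1 (fun k M => P.A * M + P.B * G k) t with hH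
  have H0 : H 0 = 1 := rfl
  have Hs : ∀ t, H (t + 1) = P.A * H t + P.B * G t := fun t => rfl
  have hxH : ∀ t ≤ T, x t = H t *ᵥ x 0 := by
    intro t
    induction t with
    | zero => intro _; simp [H0]
    | succ k ih =>
      intro hk
      rw [h.nominal k (by omega), ih (by omega), hG k, Hs]
      simp [Matrix.add_mulVec, Matrix.mulVec_mulVec]
  let s : SLSVar T nx nu := ⟨.ofResponse T H X, .ofResponse T G U, fun t => σ t⟩
  have hx : ∀ t : Fin (T + 1), x t = s.Φx.block t 0 *ᵥ x 0 := fun t => by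
    rw [HorizonMatrix.block_ofResponse_zero]
    exact hxH t (by omega)
  have hu : ∀ t : Fin (T + 1), u t = s.Φu.block t 0 *ᵥ x 0 := fun t => by
    rw [HorizonMatrix.block_ofResponse_zero]
    exact hG t
  have hX : ∀ (t : Fin (T + 1)) (i : Fin T), (i : ℕ) < t → X t i = s.Φx.block t i.succ :=
    fun t i hi => by rw [HorizonMatrix.block_ofResponse_succ, if_pos hi]
  have hU : ∀ (t : Fin (T + 1)) (i : Fin T), (i : ℕ) < t → U t i = s.Φu.block t i.succ :=
    fun t i hi => by rw [HorizonMatrix.block_ofResponse_succ, if_pos hi]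
  refine ⟨s, ?_, cost_eq_trajCost hx fun t => hu t.castSucc⟩
  refine ⟨HorizonMatrix.isCausal_ofResponse _ _, HorizonMatrix.isCausal_ofResponse _ _, ?_, ?_,
    ?_, ?_, ?_⟩
  · refine (affine_iff _ _ _ _ _).2 ⟨fun j => ?_, fun t j => ?_⟩
    · refine Fin.cases ?_ (fun i => ?_) j
      · rw [HorizonMatrix.block_ofResponse_zero]
        rfl
      · rw [HorizonMatrix.block_ofResponse_succ]
        simp
    · refine Fin.cases ?_ (fun i => ?_) j
      · simp only [s, HorizonMatrix.block_ofResponse_zero]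
        simp [Hs, Fin.succ_ne_zero]
      · simp only [s, HorizonMatrix.block_ofResponse_succ, Fin.val_succ, Fin.val_castSucc]
        rcases lt_trichotomy (i : ℕ) t with hi | hi | hi
        · have hne : t ≠ i := by rintro rfl; exact lt_irrefl _ hi
          simp [hi, Nat.lt_succ_of_lt hi, hne, h.step t t.isLt i hi]
        · obtain rfl : i = t := Fin.ext hi
          simp [h.diag i i.isLt]
        · have hne : t ≠ i := by rintro rfl; exact lt_irrefl _ hi
          simp [hi.not_gt, hne, show ¬ (i : ℕ) < t + 1 by omega]
  · intro t
    rw [← signalBound_eq s.Φx (x 0) x X _ (hx _) (hX _),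
      ← signalBound_eq s.Φu (x 0) u U _ (hu _) (hU _)]
    exact h.noise_bound t t.isLt
  · exact fun t => (tightenedResponse_iff _ _ _ _ _ _ _ (hx _) (hX _)).1 (h.state t t.isLt)
  · exact fun t => (tightenedResponse_iff _ _ _ _ _ _ _ (hu _) (hU _)).1 (h.input t t.isLt)
  · exact (tightenedResponse_iff _ _ _ _ _ _ (Fin.last T) (hx _) (hX _)).1 h.terminal

end RobustMPC

/-! ### Consequences of the tightened constraints -/

section Tightened

variable {m p q : ℕ} {F : Matrix (Fin m) (Fin p) ℝ} {b : Fin m → ℝ} {y : ℕ → Fin p → ℝ}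
  {Y : ℕ → ℕ → Matrix (Fin p) (Fin q) ℝ} {t : ℕ}

lemma dotProduct_mulVec_le_l1Norm (f : Fin p → ℝ) (M : Matrix (Fin p) (Fin q) ℝ) {ω : Fin q → ℝ}
    (hω : ‖ω‖ ≤ 1) : f ⬝ᵥ (M *ᵥ ω) ≤ l1Norm (f ᵥ* M) := by
  rw [Matrix.dotProduct_mulVec]
  refine (le_abs_self _).trans ((abs_dotProduct_le_l1Norm_mul _ _).trans ?_)
  exact mul_le_of_le_one_right (l1Norm_nonneg _) hω

lemma TightenedResponse.mem_polytope (h : TightenedResponse F b y Y t) : y t ∈ polytope F b :=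
  fun r => (le_add_of_nonneg_right (Finset.sum_nonneg fun _ _ => l1Norm_nonneg _)).trans (h r)

lemma TightenedResponse.add_mem_polytope (h : TightenedResponse F b y Y t) {i : ℕ} (hi : i < t)
    {ω : Fin q → ℝ} (hω : ‖ω‖ ≤ 1) : y t + Y t i *ᵥ ω ∈ polytope F b := by
  intro r
  refine le_trans ?_ (h r)
  change F r ⬝ᵥ (y t + Y t i *ᵥ ω) ≤ _
  rw [dotProduct_add]
  gcongr
  exact (dotProduct_mulVec_le_l1Norm _ _ hω).trans
    (Finset.single_le_sum (f := fun i => l1Norm (F r ᵥ* Y t i)) (fun _ _ => l1Norm_nonneg _)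
      (Finset.mem_range.2 hi))

lemma TightenedResponse.indNorm_le (h : TightenedResponse F b y Y t) {C : ℝ}
    (hC : ∀ z ∈ polytope F b, ‖z‖ ≤ C) {i : ℕ} (hi : i < t) : indNorm (Y t i) ≤ 2 * C := by
  have hy := hC _ h.mem_polytope
  refine indNorm_le_of_forall_unit (by linarith [norm_nonneg (y t)]) fun ω hω => ?_
  have h1 := hC _ (h.add_mem_polytope hi hω)
  have h2 := norm_sub_le (y t + Y t i *ᵥ ω) (y t)
  rw [add_sub_cancel_left] at h2
  linarith

/-- Once the first disturbance is known, the tightening against it is no longer needed. -/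
lemma TightenedResponse.shift (h : TightenedResponse F b y Y (t + 1)) {ω : Fin q → ℝ}
    (hω : ‖ω‖ ≤ 1) : TightenedResponse F b (fun t => y (t + 1) + Y (t + 1) 0 *ᵥ ω)
      (fun t i => Y (t + 1) (i + 1)) t := by
  intro r
  have h1 := h r
  have h2 := dotProduct_mulVec_le_l1Norm (F r) (Y (t + 1) 0) hω
  rw [Finset.sum_range_succ'] at h1
  simp only [dotProduct_add]
  linarith

lemma signalBound_shift_le {ω : Fin q → ℝ} (hω : ‖ω‖ ≤ 1) :
    signalBound (fun t => y (t + 1) + Y (t + 1) 0 *ᵥ ω) (fun t i => Y (t + 1) (i + 1)) t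
      ≤ signalBound y Y (t + 1) := by
  have h1 := norm_add_le (y (t + 1)) (Y (t + 1) 0 *ᵥ ω)
  have h2 := (norm_mulVec_le_indNorm_mul (Y (t + 1) 0) ω).trans
    (mul_le_of_le_one_right (indNorm_nonneg _) hω)
  simp only [signalBound, Finset.sum_range_succ' _ t]
  linarith

end Tightened

lemma norm_lumped_le {nx nu : ℕ} {P : RobustMPC nx nu} {ΔA : Matrix (Fin nx) (Fin nx) ℝ}
    (hA : ΔA ∈ P.setPA) {ΔB : Matrix (Fin nx) (Fin nu) ℝ} (hB : ΔB ∈ P.setPB) {w : Fin nx → ℝ}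
    (hw : w ∈ P.setW) (x : Fin nx → ℝ) (u : Fin nu → ℝ) :
    ‖lumped ΔA ΔB x u w‖ ≤ P.εA * ‖x‖ + P.εB * ‖u‖ + P.σw :=
  (norm_add₃_le).trans (add_le_add (add_le_add (norm_mulVec_le_of_indNorm_le hA x)
    (norm_mulVec_le_of_indNorm_le hB u)) hw)

namespace RobustMPC

variable {nx nu : ℕ} {P : RobustMPC nx nu}

/-- A common bound on the norm of admissible states, inputs and terminal states. -/
structure ConstraintBound (P : RobustMPC nx nu) (C : ℝ) : Prop where
  state : ∀ x ∈ P.stateSet, ‖x‖ ≤ C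
  input : ∀ u ∈ P.inputSet, ‖u‖ ≤ C
  terminal : ∀ x ∈ P.terminalSet, ‖x‖ ≤ C

lemma Standing.exists_constraintBound (hP : P.Standing) : ∃ C, P.ConstraintBound C := by
  obtain ⟨C₁, h₁⟩ := hP.isCompact_stateSet.isBounded.exists_norm_le
  obtain ⟨C₂, h₂⟩ := hP.isCompact_inputSet.isBounded.exists_norm_le
  obtain ⟨C₃, h₃⟩ := hP.isCompact_terminalSet.isBounded.exists_norm_le
  exact ⟨max C₁ (max C₂ C₃), fun x hx => le_max_of_le_left (h₁ x hx),
    fun x hx => le_max_of_le_right (le_max_of_le_left (h₂ x hx)),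
    fun x hx => le_max_of_le_right (le_max_of_le_right (h₃ x hx))⟩

lemma Standing.zero_mem_terminal (hP : P.Standing) : (0 : Fin nx → ℝ) ∈ P.terminalSet :=
  interior_subset hP.zero_mem_terminalSet

lemma ConstraintBound.nonneg {C : ℝ} (hC : P.ConstraintBound C) (hP : P.Standing) : 0 ≤ C := by
  simpa using hC.terminal 0 hP.zero_mem_terminal

section Response

variable {T : ℕ} {x : ℕ → Fin nx → ℝ} {u : ℕ → Fin nu → ℝ}
  {X : ℕ → ℕ → Matrix (Fin nx) (Fin nx) ℝ} {U : ℕ → ℕ → Matrix (Fin nu) (Fin nx) ℝ} {σ : ℕ → ℝ}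

lemma IsResponse.norm_x_le (h : P.IsResponse T x u X U σ) {C : ℝ} (hC : P.ConstraintBound C)
    {t : ℕ} (ht : t ≤ T) : ‖x t‖ ≤ C := by
  rcases ht.lt_or_eq with ht | rfl
  · exact hC.state _ (h.state t ht).mem_polytope
  · exact hC.terminal _ h.terminal.mem_polytope

lemma IsResponse.norm_u_le (h : P.IsResponse T x u X U σ) {C : ℝ} (hC : P.ConstraintBound C)
    {t : ℕ} (ht : t < T) : ‖u t‖ ≤ C :=
  hC.input _ (h.input t ht).mem_polytope

lemma IsResponse.indNorm_X_le (h : P.IsResponse T x u X U σ) {C : ℝ} (hC : P.ConstraintBound C)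
    {t i : ℕ} (ht : t ≤ T) (hi : i < t) : indNorm (X t i) ≤ 2 * C := by
  rcases ht.lt_or_eq with ht | rfl
  · exact (h.state t ht).indNorm_le hC.state hi
  · exact h.terminal.indNorm_le hC.terminal hi

lemma IsResponse.indNorm_U_le (h : P.IsResponse T x u X U σ) {C : ℝ} (hC : P.ConstraintBound C)
    {t i : ℕ} (ht : t < T) (hi : i < t) : indNorm (U t i) ≤ 2 * C :=
  (h.input t ht).indNorm_le hC.input hi

/-- The tail of a response, with the first disturbance fixed to `ω`, is a response for the horizon
shortened by one, starting from the state reached under `ω`. -/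
lemma IsResponse.shift (h : P.IsResponse (T + 1) x u X U σ) (hP : P.Standing) {ω : Fin nx → ℝ}
    (hω : ‖ω‖ ≤ 1) :
    P.IsResponse T (fun t => x (t + 1) + X (t + 1) 0 *ᵥ ω) (fun t => u (t + 1) + U (t + 1) 0 *ᵥ ω)
      (fun t i => X (t + 1) (i + 1)) (fun t i => U (t + 1) (i + 1)) (fun t => σ (t + 1)) where
  nominal t ht := by
    rw [h.nominal (t + 1) (by omega), h.step (t + 1) (by omega) 0 (by omega)]
    simp only [Matrix.add_mulVec, Matrix.mulVec_add, Matrix.mulVec_mulVec]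
    abel
  diag t ht := h.diag (t + 1) (by omega)
  step t ht i hi := h.step (t + 1) (by omega) (i + 1) (by omega)
  noise_bound t ht := by
    refine le_trans ?_ (h.noise_bound (t + 1) (by omega))
    have h1 := mul_le_mul_of_nonneg_left (signalBound_shift_le (y := x) (Y := X) (t := t) hω)
      hP.εA_nonneg
    have h2 := mul_le_mul_of_nonneg_left (signalBound_shift_le (y := u) (Y := U) (t := t) hω)
      hP.εB_nonneg
    linarith
  state t ht := (h.state (t + 1) (by omega)).shift hω
  input t ht := (h.input (t + 1) (by omega)).shift hω
  terminal := h.terminal.shift hω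

end Response

/-! ### The value function on the terminal set -/

lemma valueFn_le_optValue {T : ℕ} (hT : T ∈ Finset.Icc 1 P.Tmax) (x : Fin nx → ℝ) :
    P.valueFn x ≤ P.optValue T x :=
  iInf₂_le T hT

lemma Feasible.optValue_le {T : ℕ} {x : Fin nx → ℝ} {s : SLSVar T nx nu} (h : P.Feasible T x s) :
    P.optValue T x ≤ ENNReal.ofReal (P.cost T x s) :=
  iInf₂_le s h

lemma quadForm_terminal_le {K : Matrix (Fin nu) (Fin nx) ℝ} (hLyap : P.LocalLyapunov K)
    {x : Fin nx → ℝ} (hx : x ∈ P.terminalSet) :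
    quadForm P.Q x + quadForm P.R (K *ᵥ x) + quadForm P.QT ((P.A + P.B * K) *ᵥ x)
      ≤ quadForm P.QT x := by
  have conj : ∀ {n : ℕ} (M : Matrix (Fin n) (Fin n) ℝ) (L : Matrix (Fin n) (Fin nx) ℝ),
      x ⬝ᵥ ((Lᵀ * M * L) *ᵥ x) = quadForm M (L *ᵥ x) := by
    intro n M L
    rw [quadForm, Matrix.mul_assoc, ← Matrix.mulVec_mulVec, Matrix.dotProduct_mulVec,
      Matrix.vecMul_transpose, ← Matrix.mulVec_mulVec]
  have h := hLyap x hx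
  rw [Matrix.add_mulVec, Matrix.add_mulVec, Matrix.add_mulVec, dotProduct_add, dotProduct_add,
    dotProduct_add, conj, conj, Matrix.neg_mulVec, dotProduct_neg] at h
  simp only [quadForm] at h ⊢
  linarith

/-- Every lumped uncertainty that is admissible in size is realized by model uncertainties and a
disturbance, so the terminal set is invariant under all of them. -/
lemma TerminalInvariant.add_mem {K : Matrix (Fin nu) (Fin nx) ℝ} (hinv : P.TerminalInvariant K)
    (hP : P.Standing) {x v : Fin nx → ℝ} (hx : x ∈ P.terminalSet) (hv : ‖v‖ ≤ 1) :
    (P.A + P.B * K) *ᵥ x + (P.εA * ‖x‖ + P.εB * ‖K *ᵥ x‖ + P.σw) • v ∈ P.terminalSet := by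
  have scale : ∀ {c : ℝ}, 0 ≤ c → ‖c • v‖ ≤ c := fun hc => by
    rw [norm_smul, Real.norm_of_nonneg hc]
    exact mul_le_of_le_one_right hc hv
  obtain ⟨ΔA, hA, hAx⟩ := exists_indNorm_le_mulVec_eq hP.εA_nonneg x ((P.εA * ‖x‖) • v)
    (scale (mul_nonneg hP.εA_nonneg (norm_nonneg _)))
  obtain ⟨ΔB, hB, hBx⟩ := exists_indNorm_le_mulVec_eq hP.εB_nonneg (K *ᵥ x)
    ((P.εB * ‖K *ᵥ x‖) • v) (scale (mul_nonneg hP.εB_nonneg (norm_nonneg _)))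
  have h := (hinv x hx).2.2 ΔA hA ΔB hB (P.σw • v) (scale hP.σw_pos.le)
  convert h using 1
  rw [Matrix.add_mul, Matrix.add_mulVec, Matrix.add_mulVec, Matrix.add_mulVec, Matrix.add_mulVec,
    hAx, ← Matrix.mulVec_mulVec x ΔB K, hBx, add_smul, add_smul]
  abel

/-- On the terminal set the local controller is feasible for the horizon one, at a cost of at most
the terminal cost. -/
lemma exists_feasible_of_mem_terminalSet (hP : P.Standing) {K : Matrix (Fin nu) (Fin nx) ℝ}
    (hinv : P.TerminalInvariant K) (hLyap : P.LocalLyapunov K) {x : Fin nx → ℝ}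
    (hx : x ∈ P.terminalSet) :
    ∃ s : SLSVar 1 nx nu, P.Feasible 1 x s ∧ P.cost 1 x s ≤ quadForm P.QT x := by
  set σ₀ : ℝ := P.εA * ‖x‖ + P.εB * ‖K *ᵥ x‖ + P.σw with hσ
  have hσ0 : 0 ≤ σ₀ := add_nonneg (add_nonneg (mul_nonneg hP.εA_nonneg (norm_nonneg _))
    (mul_nonneg hP.εB_nonneg (norm_nonneg _))) hP.σw_pos.le
  have hresp : P.IsResponse 1 (fun t => if t = 0 then x else (P.A + P.B * K) *ᵥ x)
      (fun _ => K *ᵥ x) (fun _ _ => σ₀ • 1) (fun _ _ => 0) (fun _ => σ₀) := by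
    constructor
    · intro t ht
      obtain rfl : t = 0 := by omega
      simp [Matrix.add_mulVec, Matrix.mulVec_mulVec]
    · simp
    · intro t ht i hi
      omega
    · intro t ht
      obtain rfl : t = 0 := by omega
      simp [signalBound, hσ]
    · intro t ht r
      obtain rfl : t = 0 := by omega
      have h : P.FX r ⬝ᵥ x ≤ P.bX r := (hinv x hx).1 r
      simpa using h
    · intro t ht r
      obtain rfl : t = 0 := by omega
      have h : P.FU r ⬝ᵥ (K *ᵥ x) ≤ P.bU r := (hinv x hx).2.1 r
      simpa only [Finset.range_zero, Finset.sum_empty, add_zero] using h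
    · intro r
      obtain ⟨v, hv, hfv⟩ := exists_dotProduct_eq_l1Norm (P.FT r)
      have h : P.FT r ⬝ᵥ _ ≤ P.bT r := hinv.add_mem hP hx hv r
      rw [dotProduct_add, dotProduct_smul, hfv, ← hσ, smul_eq_mul] at h
      simpa [Matrix.vecMul_smul, l1Norm_smul, abs_of_nonneg hσ0] using h
  obtain ⟨s, hs, hcost⟩ := hresp.exists_feasible fun t => ⟨K, by simp⟩
  refine ⟨s, by simpa using hs, ?_⟩
  have h2 := quadForm_terminal_le hLyap hx
  simp only [if_true] at hcost
  rw [hcost]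
  simpa [trajCost] using h2

lemma mem_feasibleSet_and_valueFn_le_of_mem_terminalSet (hP : P.Standing)
    {K : Matrix (Fin nu) (Fin nx) ℝ} (hinv : P.TerminalInvariant K) (hLyap : P.LocalLyapunov K)
    {x : Fin nx → ℝ} (hx : x ∈ P.terminalSet) :
    x ∈ P.feasibleSet ∧ P.valueFn x ≤ ENNReal.ofReal (quadForm P.QT x) := by
  obtain ⟨s, hs, hc⟩ := exists_feasible_of_mem_terminalSet hP hinv hLyap hx
  have h1 : 1 ∈ Finset.Icc 1 P.Tmax := Finset.mem_Icc.2 ⟨le_rfl, hP.one_le_Tmax⟩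
  exact ⟨⟨1, h1, s, hs⟩, (valueFn_le_optValue h1 x).trans
    (hs.optValue_le.trans (ENNReal.ofReal_le_ofReal hc))⟩

/-- Responses bound the value function. For the initial state `0`, where nominal inputs need not be
linear in the state, the value is `0`. -/
lemma IsResponse.mem_feasibleSet_and_valueFn_le (hP : P.Standing) {K : Matrix (Fin nu) (Fin nx) ℝ}
    (hinv : P.TerminalInvariant K) (hLyap : P.LocalLyapunov K)
    {T : ℕ} (hT : T ∈ Finset.Icc 1 P.Tmax) {x : ℕ → Fin nx → ℝ} {u : ℕ → Fin nu → ℝ}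
    {X : ℕ → ℕ → Matrix (Fin nx) (Fin nx) ℝ} {U : ℕ → ℕ → Matrix (Fin nu) (Fin nx) ℝ} {σ : ℕ → ℝ}
    (h : P.IsResponse T x u X U σ) :
    x 0 ∈ P.feasibleSet ∧ P.valueFn (x 0) ≤ ENNReal.ofReal (P.trajCost T x u) := by
  by_cases h0 : x 0 = 0
  · obtain ⟨h1, h2⟩ :=
      mem_feasibleSet_and_valueFn_le_of_mem_terminalSet hP hinv hLyap hP.zero_mem_terminal
    rw [h0]
    exact ⟨h1, h2.trans (by simp)⟩
  · obtain ⟨s, hs, hc⟩ := h.exists_feasible fun t => exists_mulVec_eq_of_ne_zero h0 (u t)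
    exact ⟨⟨T, hT, s, hs⟩, hc ▸ (valueFn_le_optValue hT _).trans hs.optValue_le⟩

/-! ### Decrease of the value function along the closed loop -/

/-- The cost of the perturbed tail of a trajectory differs from the tail cost by at most a multiple
of the size `δ` of the perturbation. -/
lemma exists_trajCost_shift_le (P : RobustMPC nx nu) (C : ℝ) :
    ∃ L : ℝ, 0 ≤ L ∧ ∀ T ≤ P.Tmax, ∀ (x x' : ℕ → Fin nx → ℝ) (u u' : ℕ → Fin nu → ℝ) (δ : ℝ),
      0 ≤ δ → (∀ t ≤ T, ‖x' t‖ ≤ C ∧ ‖x (t + 1)‖ ≤ C ∧ ‖x' t - x (t + 1)‖ ≤ δ) →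
      (∀ t < T, ‖u' t‖ ≤ C ∧ ‖u (t + 1)‖ ≤ C ∧ ‖u' t - u (t + 1)‖ ≤ δ) →
      P.trajCost T x' u' ≤
        P.trajCost (T + 1) x u - (quadForm P.Q (x 0) + quadForm P.R (u 0)) + L * δ := by
  obtain ⟨LQ, hLQ, hQ⟩ := exists_quadForm_le_add P.Q C
  obtain ⟨LR, hLR, hR⟩ := exists_quadForm_le_add P.R C
  obtain ⟨LT, hLT, hT⟩ := exists_quadForm_le_add P.QT C
  refine ⟨P.Tmax * (LQ + LR) + LT, by positivity, ?_⟩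
  intro T hTm x x' u u' δ hδ hx hu
  have hsum : ∑ t ∈ Finset.range T, (quadForm P.Q (x' t) + quadForm P.R (u' t)) ≤
      ∑ t ∈ Finset.range T, (quadForm P.Q (x (t + 1)) + quadForm P.R (u (t + 1)))
        + P.Tmax * (LQ + LR) * δ := by
    have h1 : ∀ t ∈ Finset.range T, quadForm P.Q (x' t) + quadForm P.R (u' t) ≤
        (quadForm P.Q (x (t + 1)) + quadForm P.R (u (t + 1))) + (LQ + LR) * δ := by
      intro t ht
      have ht := Finset.mem_range.1 ht
      obtain ⟨a1, a2, a3⟩ := hx t ht.le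
      obtain ⟨b1, b2, b3⟩ := hu t ht
      have := hQ _ _ a1 a2
      have := hR _ _ b1 b2
      have := mul_le_mul_of_nonneg_left a3 hLQ
      have := mul_le_mul_of_nonneg_left b3 hLR
      linarith
    refine (Finset.sum_le_sum h1).trans ?_
    rw [Finset.sum_add_distrib, Finset.sum_const, Finset.card_range, nsmul_eq_mul]
    have : (T : ℝ) * ((LQ + LR) * δ) ≤ P.Tmax * ((LQ + LR) * δ) := by
      have : (T : ℝ) ≤ P.Tmax := by exact_mod_cast hTm
      gcongr
    linarith
  obtain ⟨a1, a2, a3⟩ := hx T le_rfl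
  have h1 := hT _ _ a1 a2
  have h2 := mul_le_mul_of_nonneg_left a3 hLT
  rw [trajCost, trajCost, Finset.sum_range_succ' _ T]
  linarith

/-- The decrease along the closed loop: the state reached after applying the first input of a
response stays feasible, and the value there is bounded by the remaining nominal cost up to a term
linear in the lumped uncertainty. For a horizon greater than one this is the shifted response; for
the horizon one the state is in the terminal set. -/
lemma exists_valueFn_succ_le (hP : P.Standing) {K : Matrix (Fin nu) (Fin nx) ℝ}
    (hinv : P.TerminalInvariant K) (hLyap : P.LocalLyapunov K) (hR : P.R.PosDef) :
    ∃ L : ℝ, 0 ≤ L ∧ ∀ T ∈ Finset.Icc 1 P.Tmax, ∀ (x : ℕ → Fin nx → ℝ) (u : ℕ → Fin nu → ℝ)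
      (X : ℕ → ℕ → Matrix (Fin nx) (Fin nx) ℝ) (U : ℕ → ℕ → Matrix (Fin nu) (Fin nx) ℝ)
      (σ : ℕ → ℝ), P.IsResponse T x u X U σ → ∀ η : Fin nx → ℝ,
      ‖η‖ ≤ P.εA * ‖x 0‖ + P.εB * ‖u 0‖ + P.σw →
      P.succ (x 0) (u 0) η ∈ P.feasibleSet ∧ P.valueFn (P.succ (x 0) (u 0) η) ≤
        ENNReal.ofReal (P.trajCost T x u - quadForm P.Q (x 0) + L * ‖η‖) := by
  obtain ⟨C, hC⟩ := hP.exists_constraintBound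
  have hC0 := hC.nonneg hP
  obtain ⟨L₁, hL₁, hcost⟩ := P.exists_trajCost_shift_le C
  obtain ⟨L₂, hL₂, hterm⟩ := exists_quadForm_le_add P.QT C
  have hσw := hP.σw_pos
  refine ⟨L₁ * (2 * C / P.σw) + L₂, by positivity, ?_⟩
  intro T hT x u X U σ h η hη
  obtain ⟨hT1, hTmax⟩ := Finset.mem_Icc.1 hT
  obtain ⟨N, rfl⟩ : ∃ N, T = N + 1 := ⟨T - 1, by omega⟩
  have hσ0 : P.εA * ‖x 0‖ + P.εB * ‖u 0‖ + P.σw ≤ σ 0 := by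
    simpa [signalBound] using h.noise_bound 0 (by omega)
  have hσw0 : P.σw ≤ σ 0 := by
    have h1 := mul_nonneg hP.εA_nonneg (norm_nonneg (x 0))
    have h2 := mul_nonneg hP.εB_nonneg (norm_nonneg (u 0))
    linarith
  have hpos : 0 < σ 0 := hσw.trans_le hσw0
  -- the lumped uncertainty is the filter `σ 0` applied to a normalized disturbance
  set ω : Fin nx → ℝ := (σ 0)⁻¹ • η with hω
  have hωη : ‖ω‖ = ‖η‖ / σ 0 := by
    rw [hω, norm_smul, norm_inv, Real.norm_of_nonneg hpos.le, inv_mul_eq_div]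
  have hω1 : ‖ω‖ ≤ 1 := by
    rw [hωη, div_le_one hpos]
    exact hη.trans hσ0
  have hω2 : ‖ω‖ ≤ ‖η‖ / P.σw := by
    rw [hωη]
    gcongr
  have hsucc : P.succ (x 0) (u 0) η = x 1 + X 1 0 *ᵥ ω := by
    rw [h.nominal 0 (by omega), h.diag 0 (by omega), Matrix.smul_mulVec, Matrix.one_mulVec, hω,
      smul_inv_smul₀ hpos.ne', succ]
  have hR0 := hR.quadForm_nonneg (u 0)
  have hη0 : 0 ≤ L₁ * (2 * C / P.σw) * ‖η‖ := by positivity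
  rcases Nat.eq_zero_or_pos N with rfl | hN
  · have hmem : P.succ (x 0) (u 0) η ∈ P.terminalSet := by
      rw [hsucc]
      exact h.terminal.add_mem_polytope (by omega) hω1
    obtain ⟨h1, h2⟩ := mem_feasibleSet_and_valueFn_le_of_mem_terminalSet hP hinv hLyap hmem
    refine ⟨h1, h2.trans (ENNReal.ofReal_le_ofReal ?_)⟩
    have h3 := hterm _ (x 1) (hC.terminal _ hmem) (h.norm_x_le hC le_rfl)
    have h4 : P.succ (x 0) (u 0) η - x 1 = η := by
      rw [h.nominal 0 (by omega), succ]
      abel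
    rw [h4] at h3
    simp only [trajCost, Finset.sum_range_succ, Finset.sum_range_zero] at *
    linarith
  · have hs := h.shift hP hω1
    obtain ⟨h1, h2⟩ := hs.mem_feasibleSet_and_valueFn_le hP hinv hLyap
      (Finset.mem_Icc.2 ⟨hN, by omega⟩)
    rw [hsucc]
    refine ⟨h1, h2.trans (ENNReal.ofReal_le_ofReal ?_)⟩
    have hpert : ∀ {n : ℕ} {M : Matrix (Fin n) (Fin nx) ℝ}, indNorm M ≤ 2 * C →
        ‖M *ᵥ ω‖ ≤ 2 * C / P.σw * ‖η‖ := fun hM =>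
      (norm_mulVec_le_of_indNorm_le hM ω).trans
        ((mul_le_mul_of_nonneg_left hω2 (by positivity)).trans_eq (by ring))
    have h3 := hcost N (by omega) x _ u _ (2 * C / P.σw * ‖η‖) (by positivity)
      (fun t ht => ⟨hs.norm_x_le hC ht, h.norm_x_le hC (by omega), by
        rw [add_sub_cancel_left]
        exact hpert (h.indNorm_X_le hC (by omega) (by omega))⟩)
      (fun t ht => ⟨hs.norm_u_le hC ht, h.norm_u_le hC (by omega), by
        rw [add_sub_cancel_left]
        exact hpert (h.indNorm_U_le hC (by omega) (by omega))⟩)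
    have h4 : 0 ≤ L₂ * ‖η‖ := by positivity
    linarith

end RobustMPC

/-! ### Compactness of the set of responses -/

/-- The families `(x, u, X, U, σ)` of a response, with the product topology. -/
abbrev ResponseSpace (nx nu : ℕ) : Type :=
  (ℕ → Fin nx → ℝ) × (ℕ → Fin nu → ℝ) × (ℕ → ℕ → Matrix (Fin nx) (Fin nx) ℝ) ×
    (ℕ → ℕ → Matrix (Fin nu) (Fin nx) ℝ) × (ℕ → ℝ)

/-- The families all of whose entries are bounded by `C`. -/
def responseBox (nx nu : ℕ) (C : ℝ) : Set (ResponseSpace nx nu) :=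
  (Set.univ.pi fun _ => Metric.closedBall 0 C) ×ˢ (Set.univ.pi fun _ => Metric.closedBall 0 C) ×ˢ
    (Set.univ.pi fun _ => Set.univ.pi fun _ => Set.univ.pi fun _ => Set.univ.pi fun _ =>
      Set.Icc (-C) C) ×ˢ
    (Set.univ.pi fun _ => Set.univ.pi fun _ => Set.univ.pi fun _ => Set.univ.pi fun _ =>
      Set.Icc (-C) C) ×ˢ
    (Set.univ.pi fun _ => Set.Icc (-C) C)

lemma isCompact_responseBox (nx nu : ℕ) (C : ℝ) : IsCompact (responseBox nx nu C) := by
  have hM : ∀ m n : ℕ, IsCompact (Set.univ.pi fun _ => Set.univ.pi fun _ => Set.univ.pi fun _ =>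
      Set.univ.pi fun _ => Set.Icc (-C) C : Set (ℕ → ℕ → Matrix (Fin m) (Fin n) ℝ)) :=
    fun m n => isCompact_univ_pi fun _ => isCompact_univ_pi fun _ =>
      isCompact_univ_pi (X := fun _ : Fin m => Fin n → ℝ) fun _ => isCompact_univ_pi fun _ =>
        isCompact_Icc
  exact (isCompact_univ_pi fun _ => isCompact_closedBall _ _).prod
    ((isCompact_univ_pi fun _ => isCompact_closedBall _ _).prod
      ((hM nx nx).prod ((hM nu nx).prod (isCompact_univ_pi fun _ => isCompact_Icc))))

section Continuity

variable {m p q : ℕ} {α : Type*} [TopologicalSpace α] {y : α → ℕ → Fin p → ℝ}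
  {Y : α → ℕ → ℕ → Matrix (Fin p) (Fin q) ℝ}

lemma continuous_signalBound (hy : Continuous y) (hY : Continuous Y) (t : ℕ) :
    Continuous fun d => signalBound (y d) (Y d) t := by
  have h : ∀ i, Continuous fun d => indNorm (Y d t i) := fun i =>
    continuous_indNorm.comp (by fun_prop)
  unfold signalBound
  fun_prop

lemma isClosed_tightenedResponse (F : Matrix (Fin m) (Fin p) ℝ) (b : Fin m → ℝ)
    (hy : Continuous y) (hY : Continuous Y) (t : ℕ) :
    IsClosed {d | TightenedResponse F b (y d) (Y d) t} := by
  simp only [TightenedResponse, Set.ofPred_forall]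
  refine isClosed_iInter fun r => isClosed_le ?_ continuous_const
  have h : ∀ i, Continuous fun d => l1Norm (F r ᵥ* Y d t i) := fun i =>
    continuous_l1Norm.comp (by fun_prop)
  fun_prop

end Continuity

namespace RobustMPC

variable {nx nu : ℕ} {P : RobustMPC nx nu}

lemma isResponse_iff {T : ℕ} {x : ℕ → Fin nx → ℝ} {u : ℕ → Fin nu → ℝ}
    {X : ℕ → ℕ → Matrix (Fin nx) (Fin nx) ℝ} {U : ℕ → ℕ → Matrix (Fin nu) (Fin nx) ℝ}
    {σ : ℕ → ℝ} : P.IsResponse T x u X U σ ↔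
      (∀ t < T, x (t + 1) = P.A *ᵥ x t + P.B *ᵥ u t) ∧
      (∀ t < T, X (t + 1) t = σ t • 1) ∧
      (∀ t < T, ∀ i < t, X (t + 1) i = P.A * X t i + P.B * U t i) ∧
      (∀ t < T, P.εA * signalBound x X t + P.εB * signalBound u U t + P.σw ≤ σ t) ∧
      (∀ t < T, TightenedResponse P.FX P.bX x X t) ∧
      (∀ t < T, TightenedResponse P.FU P.bU u U t) ∧
      TightenedResponse P.FT P.bT x X T :=
  ⟨fun ⟨h1, h2, h3, h4, h5, h6, h7⟩ => ⟨h1, h2, h3, h4, h5, h6, h7⟩,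
    fun ⟨h1, h2, h3, h4, h5, h6, h7⟩ => ⟨h1, h2, h3, h4, h5, h6, h7⟩⟩

/-- The responses for the horizon `T`. -/
def responses (P : RobustMPC nx nu) (T : ℕ) : Set (ResponseSpace nx nu) :=
  {d | P.IsResponse T d.1 d.2.1 d.2.2.1 d.2.2.2.1 d.2.2.2.2}

lemma isClosed_responses (P : RobustMPC nx nu) (T : ℕ) : IsClosed (P.responses T) := by
  have hx : Continuous fun d : ResponseSpace nx nu => d.1 := by fun_prop
  have hu : Continuous fun d : ResponseSpace nx nu => d.2.1 := by fun_prop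
  have hX : Continuous fun d : ResponseSpace nx nu => d.2.2.1 := by fun_prop
  have hU : Continuous fun d : ResponseSpace nx nu => d.2.2.2.1 := by fun_prop
  have hσ : Continuous fun d : ResponseSpace nx nu => d.2.2.2.2 := by fun_prop
  simp only [responses, isResponse_iff, Set.ofPred_and, Set.ofPred_forall]
  refine .inter ?_ (.inter ?_ (.inter ?_ (.inter ?_ (.inter ?_ (.inter ?_ ?_)))))
  · exact isClosed_iInter fun t => isClosed_iInter fun _ =>
      isClosed_eq (by fun_prop) (by fun_prop)
  · exact isClosed_iInter fun t => isClosed_iInter fun _ =>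
      isClosed_eq (by fun_prop) (by fun_prop)
  · exact isClosed_iInter fun t => isClosed_iInter fun _ => isClosed_iInter fun i =>
      isClosed_iInter fun _ => isClosed_eq (by fun_prop) (by fun_prop)
  · refine isClosed_iInter fun t => isClosed_iInter fun _ => isClosed_le ?_ (by fun_prop)
    have h1 := continuous_signalBound hx hX t
    have h2 := continuous_signalBound hu hU t
    fun_prop
  · exact isClosed_iInter fun t => isClosed_iInter fun _ =>
      isClosed_tightenedResponse _ _ hx hX t
  · exact isClosed_iInter fun t => isClosed_iInter fun _ =>
      isClosed_tightenedResponse _ _ hu hU t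
  · exact isClosed_tightenedResponse _ _ hx hX T

lemma continuous_trajCost (P : RobustMPC nx nu) (T : ℕ) :
    Continuous fun d : ResponseSpace nx nu => P.trajCost T d.1 d.2.1 := by
  have hQ := continuous_quadForm P.Q
  have hR := continuous_quadForm P.R
  have hQT := continuous_quadForm P.QT
  unfold trajCost
  fun_prop

lemma trajCost_congr {T : ℕ} {x x' : ℕ → Fin nx → ℝ} {u u' : ℕ → Fin nu → ℝ}
    (hx : ∀ t ≤ T, x' t = x t) (hu : ∀ t < T, u' t = u t) :
    P.trajCost T x' u' = P.trajCost T x u := by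
  rw [trajCost, trajCost, hx T le_rfl]
  congr 1
  refine Finset.sum_congr rfl fun t ht => ?_
  have ht := Finset.mem_range.1 ht
  rw [hx t ht.le, hu t ht]

section Response

variable {T : ℕ} {x x' : ℕ → Fin nx → ℝ} {u u' : ℕ → Fin nu → ℝ}
  {X X' : ℕ → ℕ → Matrix (Fin nx) (Fin nx) ℝ} {U U' : ℕ → ℕ → Matrix (Fin nu) (Fin nx) ℝ}
  {σ σ' : ℕ → ℝ}

lemma IsResponse.congr (h : P.IsResponse T x u X U σ) (hx : ∀ t ≤ T, x' t = x t)
    (hu : ∀ t < T, u' t = u t) (hX : ∀ t ≤ T, ∀ i < t, X' t i = X t i)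
    (hU : ∀ t < T, ∀ i < t, U' t i = U t i) (hσ : ∀ t < T, σ' t = σ t) :
    P.IsResponse T x' u' X' U' σ' := by
  have tight : ∀ {m p : ℕ} {F : Matrix (Fin m) (Fin p) ℝ} {b : Fin m → ℝ} {y y' : ℕ → Fin p → ℝ}
      {Y Y' : ℕ → ℕ → Matrix (Fin p) (Fin nx) ℝ} {t : ℕ}, y' t = y t → (∀ i < t, Y' t i = Y t i) →
      TightenedResponse F b y Y t → TightenedResponse F b y' Y' t := by
    intro m p F b y y' Y Y' t hy hY h r
    rw [hy, Finset.sum_congr rfl fun i hi => by rw [hY i (Finset.mem_range.1 hi)]]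
    exact h r
  have bound : ∀ {p : ℕ} {y y' : ℕ → Fin p → ℝ}
      {Y Y' : ℕ → ℕ → Matrix (Fin p) (Fin nx) ℝ} {t : ℕ}, y' t = y t → (∀ i < t, Y' t i = Y t i) →
      signalBound y' Y' t = signalBound y Y t := by
    intro p y y' Y Y' t hy hY
    rw [signalBound, signalBound, hy,
      Finset.sum_congr rfl fun i hi => by rw [hY i (Finset.mem_range.1 hi)]]
  constructor
  · intro t ht
    rw [hx (t + 1) ht, hx t ht.le, hu t ht, h.nominal t ht]
  · intro t ht
    rw [hX (t + 1) ht t (by omega), hσ t ht, h.diag t ht]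
  · intro t ht i hi
    rw [hX (t + 1) ht i (by omega), hX t ht.le i hi, hU t ht i hi, h.step t ht i hi]
  · intro t ht
    rw [bound (hx t ht.le) (hX t ht.le), bound (hu t ht) (hU t ht), hσ t ht]
    exact h.noise_bound t ht
  · exact fun t ht => tight (hx t ht.le) (hX t ht.le) (h.state t ht)
  · exact fun t ht => tight (hu t ht) (hU t ht) (h.input t ht)
  · exact tight (hx T le_rfl) (hX T le_rfl) h.terminal

/-- Every response can be replaced by a uniformly bounded one with the same initial state and cost,
by setting all irrelevant values to zero. The bound on `σ` comes from the diagonal blocks `σ t • 1`,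
so that the state space has to be nontrivial. -/
lemma IsResponse.exists_mem_responseBox (h : P.IsResponse T x u X U σ) (hP : P.Standing)
    (hnx : Nonempty (Fin nx)) {C : ℝ} (hC : P.ConstraintBound C) :
    ∃ d ∈ P.responses T ∩ responseBox nx nu (2 * C), d.1 0 = x 0 ∧
      P.trajCost T d.1 d.2.1 = P.trajCost T x u := by
  have hC0 := hC.nonneg hP
  have hmat : ∀ {m n : ℕ} {M : Matrix (Fin m) (Fin n) ℝ}, indNorm M ≤ 2 * C →
      ∀ a b, M a b ∈ Set.Icc (-(2 * C)) (2 * C) := fun hM a b =>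
    abs_le.1 ((abs_entry_le_indNorm _ a b).trans hM)
  have hzero : (0 : ℝ) ∈ Set.Icc (-(2 * C)) (2 * C) := ⟨by linarith, by linarith⟩
  refine ⟨⟨fun t => if t ≤ T then x t else 0, fun t => if t < T then u t else 0,
    fun t i => if t ≤ T ∧ i < t then X t i else 0, fun t i => if t < T ∧ i < t then U t i else 0,
    fun t => if t < T then σ t else 0⟩, ⟨?_, ?_, ?_, ?_, ?_, ?_⟩, by simp,
    trajCost_congr (by simp +contextual) (by simp +contextual)⟩
  · refine h.congr ?_ ?_ ?_ ?_ ?_ <;> simp +contextual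
  · intro t _
    by_cases ht : t ≤ T
    · simpa [ht] using (h.norm_x_le hC ht).trans (by linarith)
    · simpa [ht] using hC0
  · intro t _
    by_cases ht : t < T
    · simpa [ht] using (h.norm_u_le hC ht).trans (by linarith)
    · simpa [ht] using hC0
  · intro t _ i _ a _ b _
    by_cases ht : t ≤ T ∧ i < t
    · simpa only [ht, and_self, if_true] using hmat (h.indNorm_X_le hC ht.1 ht.2) a b
    · simpa only [ht, if_false, Matrix.zero_apply] using hzero
  · intro t _ i _ a _ b _
    by_cases ht : t < T ∧ i < t
    · simpa only [ht, and_self, if_true] using hmat (h.indNorm_U_le hC ht.1 ht.2) a b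
    · simpa only [ht, if_false, Matrix.zero_apply] using hzero
  · intro t _
    by_cases ht : t < T
    · obtain ⟨a⟩ := hnx
      have := hmat (h.indNorm_X_le hC (t := t + 1) ht t.lt_succ_self) a a
      rw [h.diag t ht, Matrix.smul_apply, Matrix.one_apply_eq, smul_eq_mul, mul_one] at this
      simpa only [ht, if_true] using this
    · simpa only [ht, if_false] using hzero

end Response

lemma isCompact_responses_inter_box (P : RobustMPC nx nu) (T : ℕ) (C : ℝ) :
    IsCompact (P.responses T ∩ responseBox nx nu C) :=
  (isCompact_responseBox nx nu C).inter_left (P.isClosed_responses T)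

lemma nonempty_fin_of_ne_zero {n : ℕ} {x : Fin n → ℝ} (hx : x ≠ 0) : Nonempty (Fin n) := by
  by_contra h
  rw [not_nonempty_iff] at h
  exact hx (Subsingleton.elim _ _)

/-! ### Optimal solutions and the feasible set -/

/-- Feasible programs have optimal solutions. At the initial state `0` all costs vanish; elsewhere
the cost attains its minimum over a compact set of responses. -/
lemma Feasible.exists_isOptimal (hP : P.Standing) {T : ℕ} {x₀ : Fin nx → ℝ} {s : SLSVar T nx nu}
    (hs : P.Feasible T x₀ s) : ∃ s', P.IsOptimal T x₀ s' := by
  suffices ∃ s', P.Feasible T x₀ s' ∧ ∀ s'', P.Feasible T x₀ s'' →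
      P.cost T x₀ s' ≤ P.cost T x₀ s'' by
    obtain ⟨s', h1, h2⟩ := this
    exact ⟨s', h1, le_antisymm (le_iInf₂ fun s'' h'' => ENNReal.ofReal_le_ofReal (h2 s'' h''))
      h1.optValue_le⟩
  by_cases h0 : x₀ = 0
  · subst h0
    exact ⟨s, hs, fun s'' _ => by simp [cost]⟩
  obtain ⟨C, hC⟩ := hP.exists_constraintBound
  have hnx := nonempty_fin_of_ne_zero h0
  have bounded : ∀ {s}, P.Feasible T x₀ s → ∃ d ∈ (P.responses T ∩ responseBox nx nu (2 * C)) ∩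
      {d | d.1 0 = x₀}, P.trajCost T d.1 d.2.1 = P.cost T x₀ s := by
    intro s hs
    obtain ⟨x, u, X, U, σ, h, hx, -, hcost⟩ := hs.exists_isResponse
    obtain ⟨d, hd, hd0, hdc⟩ := h.exists_mem_responseBox hP hnx hC
    exact ⟨d, ⟨hd, hd0.trans hx⟩, hdc.trans hcost.symm⟩
  have hcl : IsClosed {d : ResponseSpace nx nu | d.1 0 = x₀} :=
    isClosed_eq (by fun_prop) continuous_const
  obtain ⟨d₀, hd₀, -⟩ := bounded hs
  obtain ⟨d, hd, hmin⟩ := ((P.isCompact_responses_inter_box T (2 * C)).inter_right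
    hcl).exists_isMinOn ⟨d₀, hd₀⟩ (P.continuous_trajCost T).continuousOn
  have hd0 : d.1 0 = x₀ := hd.2
  have hresp : P.IsResponse T d.1 d.2.1 d.2.2.1 d.2.2.2.1 d.2.2.2.2 := hd.1.1
  obtain ⟨s', hs', hc'⟩ := hresp.exists_feasible
    fun t => exists_mulVec_eq_of_ne_zero (hd0 ▸ h0) (d.2.1 t)
  rw [hd0] at hs' hc'
  refine ⟨s', hs', fun s'' hs'' => ?_⟩
  obtain ⟨d'', hd'', hc''⟩ := bounded hs''
  rw [hc', ← hc'']
  exact isMinOn_iff.1 hmin d'' hd''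

lemma mpcInputs_nonempty (hP : P.Standing) {x : Fin nx → ℝ} (hx : x ∈ P.feasibleSet) :
    (P.mpcInputs x).Nonempty := by
  obtain ⟨T₀, hT₀, s₀, hs₀⟩ := hx
  obtain ⟨T, hT, hmin⟩ := (Finset.Icc 1 P.Tmax).exists_min_image (fun T => P.optValue T x)
    ⟨T₀, hT₀⟩
  have hval : P.optValue T x = P.valueFn x :=
    le_antisymm (le_iInf₂ hmin) (valueFn_le_optValue hT x)
  have hfeas : ∃ s, P.Feasible T x s := by
    by_contra! hne
    have h1 : P.optValue T x = ⊤ := by simp [optValue, hne]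
    have h2 := (hmin T₀ hT₀).trans hs₀.optValue_le
    rw [h1] at h2
    exact ENNReal.ofReal_ne_top (top_le_iff.1 h2)
  obtain ⟨s, hs⟩ := hfeas
  obtain ⟨s', hs'⟩ := hs.exists_isOptimal hP
  exact ⟨_, T, hT, hval, s', hs', rfl⟩

lemma isCompact_feasibleSet (hP : P.Standing) {K : Matrix (Fin nu) (Fin nx) ℝ}
    (hinv : P.TerminalInvariant K) (hLyap : P.LocalLyapunov K) : IsCompact P.feasibleSet := by
  -- in a trivial state space the constraints do not bound `σ`, but there is only one state
  rcases isEmpty_or_nonempty (Fin nx) with hnx | hnx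
  · exact (Set.subsingleton_of_subsingleton.finite).isCompact
  obtain ⟨C, hC⟩ := hP.exists_constraintBound
  have : P.feasibleSet = ⋃ T ∈ Finset.Icc 1 P.Tmax,
      (fun d : ResponseSpace nx nu => d.1 0) '' (P.responses T ∩ responseBox nx nu (2 * C)) := by
    ext x₀
    simp only [Set.mem_iUnion, Set.mem_image, exists_prop]
    constructor
    · rintro ⟨T, hT, s, hs⟩
      obtain ⟨x, u, X, U, σ, h, hx, -, -⟩ := hs.exists_isResponse
      obtain ⟨d, hd, hd0, -⟩ := h.exists_mem_responseBox hP hnx hC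
      exact ⟨T, hT, d, hd, hd0.trans hx⟩
    · rintro ⟨T, hT, d, hd, rfl⟩
      exact (IsResponse.mem_feasibleSet_and_valueFn_le hP hinv hLyap hT hd.1).1
  rw [this]
  exact Finset.isCompact_biUnion _ fun T _ =>
    (P.isCompact_responses_inter_box T (2 * C)).image (by fun_prop)

end RobustMPC

/-! ### Input-to-state stability from a quadratic Lyapunov function -/

lemma isClassKInf_const_mul_sq {c : ℝ≥0} (hc : 0 < c) : IsClassKInf fun s => c * s ^ 2 :=
  ⟨⟨by fun_prop, fun a b hab => by dsimp only; gcongr, by simp⟩,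
    (Filter.tendsto_pow_atTop two_ne_zero).const_mul_atTop hc⟩

lemma isClassK_const_mul {c : ℝ≥0} (hc : 0 < c) : IsClassK fun s => c * s :=
  ⟨by fun_prop, fun a b hab => by dsimp only; gcongr, by simp⟩

lemma isClassK_sqrt_const_mul {c : ℝ≥0} (hc : 0 < c) : IsClassK fun s => NNReal.sqrt (c * s) :=
  ⟨NNReal.continuous_sqrt.comp (by fun_prop),
    NNReal.sqrt.strictMono.comp (isClassK_const_mul hc).2.1, by simp⟩

lemma isClassKL_mul_rpow {κ r : ℝ≥0} (hκ : 0 < κ) (hr : 0 < r) (hr1 : r < 1) :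
    IsClassKL fun s t => κ * s * r ^ (t : ℝ) := by
  refine ⟨fun t => ⟨by fun_prop, fun a b hab => ?_, by simp⟩, fun s => ⟨fun a b hab => ?_, ?_⟩⟩
  · have : 0 < r ^ (t : ℝ) := NNReal.rpow_pos hr
    dsimp only
    gcongr
  · have : r ^ (b : ℝ) ≤ r ^ (a : ℝ) := NNReal.rpow_le_rpow_of_exponent_ge hr hr1.le hab
    dsimp only
    gcongr
  · have h1 : Filter.Tendsto (fun t : ℝ≥0 => r ^ (t : ℝ)) Filter.atTop (nhds 0) := by
      refine NNReal.tendsto_coe.1 ?_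
      have := (tendsto_rpow_atTop_of_base_lt_one (r : ℝ) (by linarith [r.coe_nonneg])
        (by exact_mod_cast hr1)).comp (NNReal.tendsto_coe_atTop.2 Filter.tendsto_id)
      simpa [Function.comp_def] using this
    simpa using h1.const_mul (κ * s)

/-- A linear decrease with rate `c / b` gives a geometric decay up to a multiple of the largest
input. -/
lemma le_geometric_add_of_dissipation {v n e : ℕ → ℝ} {b c L : ℝ} (hc : 0 < c) (hcb : c < b)
    (hL : 0 ≤ L) (hv : ∀ k, v k ≤ b * n k ^ 2)
    (hdec : ∀ k, v (k + 1) + c * n k ^ 2 ≤ v k + L * e k) {E : ℝ} (k : ℕ)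
    (he : ∀ t < k, e t ≤ E) (hE : 0 ≤ E) : v k ≤ (1 - c / b) ^ k * v 0 + L * b / c * E := by
  have hb : 0 < b := hc.trans hcb
  induction k with
  | zero =>
    have : 0 ≤ L * b / c * E := by positivity
    simpa using this
  | succ k ih =>
    have h1 := ih fun t ht => he t (by omega)
    have h2 : c / b * v k ≤ c * n k ^ 2 :=
      (mul_le_mul_of_nonneg_left (hv k) (by positivity)).trans_eq (by field_simp)
    have h3 := mul_le_mul_of_nonneg_left (he k k.lt_succ_self) hL
    have h4 : 0 ≤ 1 - c / b := by
      rw [sub_nonneg, div_le_one hb]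
      exact hcb.le
    have h5 := mul_le_mul_of_nonneg_left h1 h4
    have h6 : (1 - c / b) * (L * b / c * E) + L * E = L * b / c * E := by
      field_simp
      ring
    have h7 := hdec k
    rw [pow_succ]
    linarith

namespace RobustMPC

variable {nx nu : ℕ} {P : RobustMPC nx nu} {μ : ℕ → (Fin nx → ℝ) → (Fin nu → ℝ)}

/-- `V` is a Lyapunov function with quadratic bounds and linear gain on a set `S` of feasible states
which is robust forward invariant. -/
structure QuadraticLyapunov (P : RobustMPC nx nu) (μ : ℕ → (Fin nx → ℝ) → (Fin nu → ℝ))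
    (V : (Fin nx → ℝ) → ℝ≥0∞) (S : Set (Fin nx → ℝ)) (b c L : ℝ≥0) : Prop where
  pos : 0 < c
  lt : c < b
  gain_pos : 0 < L
  subset : S ⊆ P.feasibleSet
  lower : ∀ x ∈ S, ((c * ‖x‖₊ ^ 2 : ℝ≥0) : ℝ≥0∞) ≤ V x
  upper : ∀ x ∈ S, V x ≤ ((b * ‖x‖₊ ^ 2 : ℝ≥0) : ℝ≥0∞)
  invariant : P.RobustInvariant μ S
  decrease : ∀ x ∈ S, ∀ k, ∀ ΔA ∈ P.setPA, ∀ ΔB ∈ P.setPB, ∀ w ∈ P.setW,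
    V (P.succ x (μ k x) (lumped ΔA ΔB x (μ k x) w)) + ((c * ‖x‖₊ ^ 2 : ℝ≥0) : ℝ≥0∞)
      ≤ V x + ((L * ‖lumped ΔA ΔB x (μ k x) w‖₊ : ℝ≥0) : ℝ≥0∞)

namespace QuadraticLyapunov

variable {V : (Fin nx → ℝ) → ℝ≥0∞} {S S' : Set (Fin nx → ℝ)} {b c L : ℝ≥0}

lemma isISSLyapunov (h : P.QuadraticLyapunov μ V S b c L) (hS : S' ⊆ S) :
    P.IsISSLyapunov μ V S' :=
  ⟨_, _, _, _, isClassKInf_const_mul_sq h.pos, isClassKInf_const_mul_sq (h.pos.trans h.lt),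
    isClassKInf_const_mul_sq h.pos, isClassK_const_mul h.gain_pos,
    fun x hx => ⟨h.lower x (hS hx), h.upper x (hS hx)⟩, fun x hx => h.decrease x (hS hx)⟩

lemma issEstimate (h : P.QuadraticLyapunov μ V S b c L) (hS : S' ⊆ S) : P.ISSEstimate μ S' := by
  have hc := h.pos
  have hb : 0 < b := h.pos.trans h.lt
  have hL := h.gain_pos
  set κ : ℝ≥0 := NNReal.sqrt (b / c) with hκ
  set r : ℝ≥0 := NNReal.sqrt (1 - c / b) with hr
  set D : ℝ≥0 := L * b / c / c with hD
  have hcb1 : c / b < 1 := (div_lt_one hb).2 h.lt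
  have hr0 : 0 < r := by
    rw [hr, NNReal.sqrt_pos]
    exact tsub_pos_of_lt hcb1
  have hr1 : r < 1 := by
    have : 1 - c / b < 1 := tsub_lt_self one_pos (div_pos hc hb)
    simpa [hr] using NNReal.sqrt_lt_sqrt.2 this
  refine ⟨fun s t => κ * s * r ^ (t : ℝ), fun s => NNReal.sqrt (D * s),
    isClassKL_mul_rpow (NNReal.sqrt_pos.2 (by positivity)) hr0 hr1,
    isClassK_sqrt_const_mul (by positivity), ?_⟩
  rintro x η ⟨ΔA, hA, ΔB, hB, w, hw⟩ hx0
  have hmem : ∀ k, x k ∈ S := by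
    intro k
    induction k with
    | zero => exact hS hx0
    | succ k ih =>
      rw [(hw k).2.2, (hw k).2.1]
      exact (h.invariant ih).2 k ΔA hA ΔB hB (w k) (hw k).1
  have htop : ∀ k, V (x k) ≠ ⊤ := fun k =>
    ((h.upper _ (hmem k)).trans_lt ENNReal.coe_lt_top).ne
  intro k
  refine ⟨h.subset (hmem k), ?_⟩
  -- the Lyapunov inequalities along the trajectory, between real numbers
  have hlow : ∀ k, (c : ℝ) * ‖x k‖ ^ 2 ≤ (V (x k)).toNNReal := by
    intro k
    have := h.lower _ (hmem k)
    rw [← ENNReal.coe_toNNReal (htop k), ENNReal.coe_le_coe] at this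
    exact_mod_cast this
  have hup : ∀ k, ((V (x k)).toNNReal : ℝ) ≤ b * ‖x k‖ ^ 2 := by
    intro k
    have := h.upper _ (hmem k)
    rw [← ENNReal.coe_toNNReal (htop k), ENNReal.coe_le_coe] at this
    exact_mod_cast this
  have hdec : ∀ k, ((V (x (k + 1))).toNNReal : ℝ) + c * ‖x k‖ ^ 2
      ≤ (V (x k)).toNNReal + L * ‖η k‖ := by
    intro k
    have := h.decrease _ (hmem k) k ΔA hA ΔB hB (w k) (hw k).1
    rw [← (hw k).2.1, ← (hw k).2.2, ← ENNReal.coe_toNNReal (htop k),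
      ← ENNReal.coe_toNNReal (htop (k + 1)), ← ENNReal.coe_add, ← ENNReal.coe_add,
      ENNReal.coe_le_coe] at this
    exact_mod_cast this
  set E : ℝ≥0 := (Finset.range (k + 1)).sup fun t => ‖η t‖₊ with hE
  have hηE : ∀ t < k, ‖η t‖ ≤ E := fun t ht => by
    have : ‖η t‖₊ ≤ E := Finset.le_sup (f := fun t => ‖η t‖₊) (Finset.mem_range.2 (by omega))
    exact_mod_cast this
  have hc' : (0 : ℝ) < c := by exact_mod_cast hc
  have hb' : (0 : ℝ) < b := by exact_mod_cast hb
  have key := le_geometric_add_of_dissipation hc' (by exact_mod_cast h.lt) L.coe_nonneg hup hdec k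
    hηE E.coe_nonneg
  have hρ : (0 : ℝ) ≤ 1 - c / b := by
    rw [sub_nonneg, div_le_one hb']
    exact_mod_cast h.lt.le
  have h1 : (c : ℝ) * ‖x k‖ ^ 2 ≤ (1 - c / b) ^ k * (b * ‖x 0‖ ^ 2) + L * b / c * E :=
    (hlow k).trans (key.trans (by gcongr; exact hup 0))
  have hκ2 : (κ : ℝ) ^ 2 = b / c := by
    rw [hκ]
    exact_mod_cast congrArg NNReal.toReal (NNReal.sq_sqrt (b / c))
  have hr2 : (r : ℝ) ^ 2 = 1 - c / b := by
    have := congrArg NNReal.toReal (NNReal.sq_sqrt (1 - c / b))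
    rw [NNReal.coe_sub hcb1.le] at this
    rw [hr]
    exact_mod_cast this
  have hs2 : ((NNReal.sqrt (D * E) : ℝ≥0) : ℝ) ^ 2 = L * b / c / c * E := by
    exact_mod_cast congrArg NNReal.toReal (NNReal.sq_sqrt (D * E))
  have h2 : ‖x k‖ ^ 2 ≤ (κ * ‖x 0‖ * r ^ k) ^ 2 + ((NNReal.sqrt (D * E) : ℝ≥0) : ℝ) ^ 2 := by
    have h3 : ((κ : ℝ) * ‖x 0‖ * r ^ k) ^ 2 = b / c * ‖x 0‖ ^ 2 * (1 - c / b) ^ k := by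
      rw [mul_pow, mul_pow, hκ2, ← pow_mul, mul_comm k 2, pow_mul, hr2]
    rw [h3, hs2, ← mul_le_mul_iff_right₀ hc']
    refine h1.trans_eq ?_
    field_simp
  have h3 : ‖x k‖ ≤ κ * ‖x 0‖ * r ^ k + (NNReal.sqrt (D * E) : ℝ≥0) := by
    refine le_of_sq_le_sq ?_ (by positivity)
    have : (0 : ℝ) ≤ κ * ‖x 0‖ * r ^ k * (NNReal.sqrt (D * E) : ℝ≥0) := by positivity
    nlinarith
  have h4 : ‖x k‖₊ ≤ κ * ‖x 0‖₊ * r ^ k + NNReal.sqrt (D * E) := by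
    rw [← NNReal.coe_le_coe]
    push_cast at h3 ⊢
    exact h3
  simpa using h4

end QuadraticLyapunov

/-! ### The value function as a Lyapunov function -/

lemma ofReal_coe_mul_norm_sq (c : ℝ≥0) {n : ℕ} (x : Fin n → ℝ) :
    ENNReal.ofReal (c * ‖x‖ ^ 2) = ((c * ‖x‖₊ ^ 2 : ℝ≥0) : ℝ≥0∞) := by
  rw [← ENNReal.ofReal_coe_nnreal]
  push_cast
  rfl

lemma terminalSet_subset_feasibleSet (hP : P.Standing) {K : Matrix (Fin nu) (Fin nx) ℝ}
    (hinv : P.TerminalInvariant K) (hLyap : P.LocalLyapunov K) :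
    P.terminalSet ⊆ P.feasibleSet :=
  fun _ hx => (mem_feasibleSet_and_valueFn_le_of_mem_terminalSet hP hinv hLyap hx).1

lemma quadForm_le_trajCost (hQ : P.Q.PosDef) (hR : P.R.PosDef) (hQT : P.QT.PosDef) {T : ℕ}
    (hT : 1 ≤ T) (x : ℕ → Fin nx → ℝ) (u : ℕ → Fin nu → ℝ) :
    quadForm P.Q (x 0) ≤ P.trajCost T x u := by
  have h1 := Finset.single_le_sum (f := fun t => quadForm P.Q (x t) + quadForm P.R (u t))
    (fun _ _ => add_nonneg (hQ.quadForm_nonneg _) (hR.quadForm_nonneg _))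
    (Finset.mem_range.2 hT)
  have h2 := hR.quadForm_nonneg (u 0)
  have h3 := hQT.quadForm_nonneg (x T)
  simp only [trajCost] at *
  linarith

lemma ofReal_quadForm_le_valueFn (hQ : P.Q.PosDef) (hR : P.R.PosDef) (hQT : P.QT.PosDef)
    (x : Fin nx → ℝ) : ENNReal.ofReal (quadForm P.Q x) ≤ P.valueFn x := by
  refine le_iInf₂ fun T hT => le_iInf₂ fun s hs => ENNReal.ofReal_le_ofReal ?_
  obtain ⟨y, u, X, U, σ, h, rfl, -, hcost⟩ := hs.exists_isResponse
  rw [hcost]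
  exact quadForm_le_trajCost hQ hR hQT (Finset.mem_Icc.1 hT).1 y u

lemma exists_valueFn_le (hP : P.Standing) :
    ∃ M : ℝ, 0 ≤ M ∧ ∀ x ∈ P.feasibleSet, P.valueFn x ≤ ENNReal.ofReal M := by
  obtain ⟨C, hC⟩ := hP.exists_constraintBound
  obtain ⟨S₁, hS₁, h₁⟩ := exists_quadForm_le P.Q C
  obtain ⟨S₂, hS₂, h₂⟩ := exists_quadForm_le P.R C
  obtain ⟨S₃, hS₃, h₃⟩ := exists_quadForm_le P.QT C
  refine ⟨P.Tmax * (S₁ + S₂) + S₃, by positivity, ?_⟩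
  rintro x₀ ⟨T, hT, s, hs⟩
  refine (valueFn_le_optValue hT x₀).trans (hs.optValue_le.trans (ENNReal.ofReal_le_ofReal ?_))
  obtain ⟨x, u, X, U, σ, h, -, -, hcost⟩ := hs.exists_isResponse
  rw [hcost, trajCost]
  refine add_le_add ?_ (h₃ _ (h.norm_x_le hC le_rfl))
  refine (Finset.sum_le_card_nsmul _ _ (S₁ + S₂) fun t ht => ?_).trans ?_
  · have ht := Finset.mem_range.1 ht
    exact add_le_add (h₁ _ (h.norm_x_le hC ht.le)) (h₂ _ (h.norm_u_le hC ht))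
  · rw [Finset.card_range, nsmul_eq_mul]
    have : (T : ℝ) ≤ P.Tmax := by exact_mod_cast (Finset.mem_Icc.1 hT).2
    gcongr

/-- The terminal cost bounds the value function on the terminal set, a neighbourhood of the origin.
Away from it the value function is bounded, hence also dominated by a quadratic function. -/
lemma exists_valueFn_le_mul_sq (hP : P.Standing) {K : Matrix (Fin nu) (Fin nx) ℝ}
    (hinv : P.TerminalInvariant K) (hLyap : P.LocalLyapunov K) :
    ∃ b : ℝ, 0 ≤ b ∧ ∀ x ∈ P.feasibleSet, P.valueFn x ≤ ENNReal.ofReal (b * ‖x‖ ^ 2) := by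
  obtain ⟨M, hM, hbd⟩ := exists_valueFn_le hP
  obtain ⟨S, hS, hQT⟩ := exists_quadForm_le_mul_sq P.QT
  obtain ⟨r, hr, hball⟩ := Metric.mem_nhds_iff.1 (mem_interior_iff_mem_nhds.1
    hP.zero_mem_terminalSet)
  refine ⟨S + M / r ^ 2, by positivity, fun x hx => ?_⟩
  have h1 : 0 ≤ S * ‖x‖ ^ 2 := by positivity
  have h2 : 0 ≤ M / r ^ 2 * ‖x‖ ^ 2 := by positivity
  by_cases hxT : x ∈ P.terminalSet
  · refine (mem_feasibleSet_and_valueFn_le_of_mem_terminalSet hP hinv hLyap hxT).2.trans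
      (ENNReal.ofReal_le_ofReal ?_)
    linarith [hQT x]
  · refine (hbd x hx).trans (ENNReal.ofReal_le_ofReal ?_)
    have hrx : r ≤ ‖x‖ := by
      by_contra! hlt
      exact hxT (hball (by simpa using hlt))
    have h3 : M ≤ M / r ^ 2 * ‖x‖ ^ 2 := by
      rw [div_mul_eq_mul_div, le_div_iff₀ (by positivity)]
      gcongr
    linarith

lemma exists_valueFn_decrease (hP : P.Standing) {K : Matrix (Fin nu) (Fin nx) ℝ}
    (hinv : P.TerminalInvariant K) (hLyap : P.LocalLyapunov K)
    (hQ : P.Q.PosDef) (hR : P.R.PosDef) (hQT : P.QT.PosDef) :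
    ∃ L : ℝ, 0 < L ∧ ∀ (x : Fin nx → ℝ), ∀ u ∈ P.mpcInputs x, ∀ η : Fin nx → ℝ,
      ‖η‖ ≤ P.εA * ‖x‖ + P.εB * ‖u‖ + P.σw →
      P.succ x u η ∈ P.feasibleSet ∧ P.valueFn (P.succ x u η) + ENNReal.ofReal (quadForm P.Q x)
        ≤ P.valueFn x + ENNReal.ofReal (L * ‖η‖) := by
  obtain ⟨L, hL, hdec⟩ := exists_valueFn_succ_le hP hinv hLyap hR
  refine ⟨L + 1, by positivity, ?_⟩
  rintro x₀ _ ⟨T, hT, hval, s, ⟨hs, hopt⟩, rfl⟩ η hη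
  obtain ⟨x, u, X, U, σ, h, rfl, hu, hcost⟩ := hs.exists_isResponse
  rw [← hu] at hη ⊢
  obtain ⟨h1, h2⟩ := hdec T hT x u X U σ h η hη
  refine ⟨h1, ?_⟩
  have hJ := quadForm_le_trajCost hQ hR hQT (Finset.mem_Icc.1 hT).1 x u
  have hq := hQ.quadForm_nonneg (x 0)
  have hη0 : 0 ≤ L * ‖η‖ := by positivity
  rw [← hval, ← hopt, hcost, ← ENNReal.ofReal_add (hq.trans hJ) (by positivity)]
  refine (add_le_add_left h2 _).trans ?_
  rw [← ENNReal.ofReal_add (by linarith) hq]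
  exact ENNReal.ofReal_le_ofReal (by linarith [norm_nonneg η])

/-- The value function is a quadratic Lyapunov function on the whole feasible set, which in
particular is robust forward invariant. -/
lemma exists_quadraticLyapunov_valueFn (hP : P.Standing) {K : Matrix (Fin nu) (Fin nx) ℝ}
    (hinv : P.TerminalInvariant K) (hLyap : P.LocalLyapunov K)
    (hQ : P.Q.PosDef) (hR : P.R.PosDef) (hQT : P.QT.PosDef) (hμ : P.IsMPCPolicy μ) :
    ∃ b c L : ℝ≥0, P.QuadraticLyapunov μ P.valueFn P.feasibleSet b c L := by
  obtain ⟨c, hc, hcQ⟩ := hQ.exists_mul_sq_le_quadForm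
  obtain ⟨b, hb, hbV⟩ := exists_valueFn_le_mul_sq hP hinv hLyap
  obtain ⟨L, hL, hdec⟩ := exists_valueFn_decrease hP hinv hLyap hQ hR hQT
  lift c to ℝ≥0 using hc.le
  lift b to ℝ≥0 using hb
  lift L to ℝ≥0 using hL.le
  have hcV : ∀ x : Fin nx → ℝ,
      ((c * ‖x‖₊ ^ 2 : ℝ≥0) : ℝ≥0∞) ≤ ENNReal.ofReal (quadForm P.Q x) := fun x => by
    rw [← ofReal_coe_mul_norm_sq]
    exact ENNReal.ofReal_le_ofReal (hcQ x)
  have hc0 : 0 < c := by exact_mod_cast hc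
  -- adding `c` and `1` makes the upper bound strictly larger than the lower one
  refine ⟨b + c + 1, c, L, hc0, ?_, by exact_mod_cast hL, subset_rfl,
    fun x _ => (hcV x).trans (ofReal_quadForm_le_valueFn hQ hR hQT x), fun x hx => ?_,
    fun x hx => ⟨hx, fun k ΔA hA ΔB hB w hw =>
      (hdec x _ (hμ k x hx) _ (norm_lumped_le hA hB hw _ _)).1⟩,
    fun x hx k ΔA hA ΔB hB w hw => ?_⟩
  · exact (lt_add_one c).trans_le (by rw [add_assoc]; exact le_add_self)
  · refine (hbV x hx).trans ?_
    rw [ofReal_coe_mul_norm_sq, ENNReal.coe_le_coe, add_assoc]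
    gcongr
    exact le_self_add
  · refine (add_le_add_right (hcV x) _).trans
      ((hdec x _ (hμ k x hx) _ (norm_lumped_le hA hB hw _ _)).2.trans_eq ?_)
    rw [← ENNReal.ofReal_coe_nnreal (p := L * _)]
    push_cast
    rfl

lemma terminalSet_subset_roa (P : RobustMPC nx nu) (μ : ℕ → (Fin nx → ℝ) → (Fin nu → ℝ)) :
    P.terminalSet ⊆ P.roa μ := fun _ hx =>
  Set.mem_iUnion₂.2 ⟨0, Finset.mem_range.2 (Nat.succ_pos _), hx⟩

lemma roa_subset_feasibleSet (h : P.terminalSet ⊆ P.feasibleSet) :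
    P.roa μ ⊆ P.feasibleSet := by
  refine Set.iUnion₂_subset fun N _ => ?_
  cases N with
  | zero => exact h
  | succ N => exact fun x hx => hx.1.1

end RobustMPC

theorem mainTheorem1 {nx nu : ℕ} (P : RobustMPC nx nu) (hP : P.Standing)
    (K : Matrix (Fin nu) (Fin nx) ℝ)
    (hstab : P.RobustlyStabilizing K) (hinv : P.TerminalInvariant K)
    (hQ : P.Q.PosDef) (hR : P.R.PosDef)
    (hQT : P.QT.PosDef) (hLyap : P.LocalLyapunov K) :
    (∀ x ∈ P.feasibleSet, (P.mpcInputs x).Nonempty) ∧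
    ∀ μ : ℕ → (Fin nx → ℝ) → (Fin nu → ℝ), P.IsMPCPolicy μ →
      0 ∈ interior (P.roa μ) ∧ P.roa μ ⊆ P.feasibleSet ∧
      P.IsISSLyapunov μ P.valueFn (P.roa μ) ∧
      P.ISSEstimate μ (P.roa μ) ∧
      P.IsISSLyapunov μ P.valueFn P.feasibleSet ∧
      P.IsISS μ P.feasibleSet := by
  refine ⟨fun x hx => P.mpcInputs_nonempty hP hx, fun μ hμ => ?_⟩
  have hT := P.terminalSet_subset_feasibleSet hP hinv hLyap
  have hroa : P.roa μ ⊆ P.feasibleSet := P.roa_subset_feasibleSet hT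
  obtain ⟨b, c, L, h⟩ := P.exists_quadraticLyapunov_valueFn hP hinv hLyap hQ hR hQT hμ
  exact ⟨interior_mono (P.terminalSet_subset_roa μ) hP.zero_mem_terminalSet, hroa,
    h.isISSLyapunov hroa, h.issEstimate hroa, h.isISSLyapunov subset_rfl,
    P.isCompact_feasibleSet hP hinv hLyap, interior_mono hT hP.zero_mem_terminalSet, h.invariant,
    h.issEstimate subset_rfl⟩
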